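/- Let $U$ be a connected Riemann surface, $x$ a nonconstant meromorphic function on $U$, and $K$ a functional differential field on $(U,x)$: a field of meromorphic functions on $U$ that contains all complex constants and is closed under the derivation $f\mapsto f'=df/dx$. An extension of $K$ is a functional differential field $L$ on $(V,\pi^*x)$, where $\pi:V\to U$ is a nonconstant analytic map from a connected Riemann surface $V$, such that $L\supset\pi^*K\cong K$. For a set $M\subset L$ let $K\langle M\rangle$ be the smallest differential subfield of $L$ containing $K$ and $M$. An element $y\in L$ is representable by generalized quadratures over $K$ if there is a chain of differential fields $K=F_0\subset F_1\subset\dots\subset F_m$ in $L$ with $y\in F_m$ and $F_{i+1}=F_i\langle y_i\rangle$, where for each $i$ the element $y_i$ is algebraic over $F_i$, or $y_i'\in F_i$, or $y_i'=ay_i$ with $a\in F_i$. Let $n\ge 1$, let $a_1,\dots,a_n\in K$, and consider the equation $$y^{(n)}+a_1y^{(n-1)}+\dots+a_ny=0.\qquad (*)$$ A monic homogeneous linear differential equation of order $n\ge 0$ over $K$ is called solvable by generalized quadratures over $K$ if some extension $L$ of $K$ contains $n$ solutions that are linearly independent over $\mathbb C$ and every solution in $L$ is representable by generalized quadratures over $K$.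 Theorem. The equation $(*)$ is solvable by generalized quadratures over $K$ if and only if, in some extension of $K$, it has a solution $y_1$ such that: 1) $y_1=\exp z$, where $z$ is a meromorphic function whose derivative $z'=f$ is algebraic over $K$; 2) the linear differential equation of order $n-1$ over the differential field $K\langle y_1\rangle$ that is obtained from $(*)$ by the reduction of order using $y_1$, i.e. the equation $$u^{(n-1)}+c_1u^{(n-2)}+\dots+c_{n-1}u=0,\qquad c_i=\frac1{y_1}\sum_{m=0}^{i}\binom{n-m}{n-i}a_m\,y_1^{(i-m)},\quad a_0=1,$$ satisfied by $u=(y/y_1)'$ for all solutions $y$ of $(*)$, is solvable by generalized quadratures over $K\langle y_1\rangle$. -/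

import Mathlib

open scoped Manifold ContDiff Differential

universe u

/-! ### Riemann surfaces and meromorphic functions -/

/-- A connected Riemann surface: a connected Hausdorff space with a holomorphic atlas
modelled on `ℂ`. -/
structure RiemannSurface where
  carrier : Type u
  [topology : TopologicalSpace carrier]
  [hausdorff : T2Space carrier]
  [connected : ConnectedSpace carrier]
  [charted : ChartedSpace ℂ carrier]
  [manifold : IsManifold 𝓘(ℂ) ω carrier]

namespace RiemannSurface

instance : CoeSort RiemannSurface.{u} (Type u) := ⟨carrier⟩

attribute [instance] topology hausdorff connected charted manifold

variable (U : RiemannSurface.{u})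

/-- `f` is meromorphic on `U`: it is so in a local coordinate around each point. The values of
`f` on a closed discrete set (in particular at the poles) are irrelevant. -/
def IsMeromorphic (f : U → ℂ) : Prop :=
  ∀ p : U, MeromorphicAt (f ∘ (chartAt ℂ p).symm) (chartAt ℂ p p)

/-- The function `df / dx` on `U`, computed at each point in a local coordinate. -/
noncomputable def derivWrt (x f : U → ℂ) : U → ℂ := fun p =>
  deriv (f ∘ (chartAt ℂ p).symm) (chartAt ℂ p p) /
    deriv (x ∘ (chartAt ℂ p).symm) (chartAt ℂ p p)

/-- Functions on `U` up to equality off a closed discrete set; two meromorphic functions are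
the same if and only if they have the same class here. -/
abbrev FunctionClass : Type u := Filter.Germ (Filter.codiscrete U) ℂ

end RiemannSurface

/-! ### Functional differential fields -/

/-- A functional differential field: a connected Riemann surface `U`, a nonconstant meromorphic
function `x` on it, and a differential field containing the complex constants that is
identified, by `toFun`, with a field of meromorphic functions on `U`, the derivation being
`f ↦ df / dx`. -/
structure FunctionalDiffField where
  surface : RiemannSurface.{u}
  x : surface → ℂ
  x_meromorphic : surface.IsMeromorphic x
  x_nonconstant : ¬ ∃ c : ℂ, (x : surface.FunctionClass) = ((fun _ => c : surface → ℂ))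
  carrier : Type u
  [field : Field carrier]
  [differential : Differential carrier]
  [algebra : Algebra ℂ carrier]
  /-- The inclusion into functions on the surface; injective, as `carrier` is a field. -/
  toFun : carrier →+* surface.FunctionClass
  meromorphic : ∀ k : carrier, ∃ f : surface → ℂ, surface.IsMeromorphic f ∧ toFun k = f
  toFun_const : ∀ c : ℂ, toFun (algebraMap ℂ carrier c) = ((fun _ => c : surface → ℂ))
  toFun_deriv : ∀ (k : carrier) (f : surface → ℂ),
    toFun k = f → toFun k′ = (surface.derivWrt x f : surface → ℂ)

namespace FunctionalDiffField

instance : CoeSort FunctionalDiffField.{u} (Type u) := ⟨carrier⟩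

attribute [instance] field differential algebra

/-- An extension of a functional differential field `K` on `(U, x)`: a functional differential
field `L` on `(V, π^* x)`, where `π : V → U` is a nonconstant analytic map of connected Riemann
surfaces, that contains `π^* K`. -/
structure Extension (K : FunctionalDiffField.{u}) where
  top : FunctionalDiffField.{u}
  proj : top.surface → K.surface
  proj_analytic : ContMDiff 𝓘(ℂ) 𝓘(ℂ) ω proj
  proj_nonconstant : ¬ ∃ p, ∀ v, proj v = p
  x_eq : (top.x : top.surface.FunctionClass) = (K.x ∘ proj : top.surface → ℂ)
  pullback : K →+* top
  toFun_pullback : ∀ (k : K) (f : K.surface → ℂ),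
    K.toFun k = f → top.toFun (pullback k) = (f ∘ proj : top.surface → ℂ)

namespace Extension

variable {K : FunctionalDiffField.{u}}

instance : CoeOut (Extension K) FunctionalDiffField.{u} := ⟨top⟩

noncomputable instance instAlgebraTop (L : Extension K) : Algebra K L.top := L.pullback.toAlgebra

/-- The adjunction `K⟨M⟩`: the smallest differential subfield of `L` that contains `K` and the
set `M`. -/
noncomputable def diffAdjoin (L : Extension K) (M : Set L.top) : IntermediateField K L.top :=
  sInf {E | (∀ z ∈ E, z′ ∈ E) ∧ M ⊆ E}

/-- `L.QuadratureTower E`: there is a chain `K = F₀ ⊆ F₁ ⊆ ⋯ ⊆ Fₘ = E` of differential subfields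
of `L` in which each `Fᵢ₊₁` is `Fᵢ⟨y⟩` with `y` algebraic over `Fᵢ`, or an integral over `Fᵢ`, or
an exponential of integral over `Fᵢ`. -/
inductive QuadratureTower (L : Extension K) : IntermediateField K L.top → Prop
  | base : QuadratureTower L ⊥
  | algebraic (E : IntermediateField K L.top) (y : L.top) :
      QuadratureTower L E → IsAlgebraic E y →
      QuadratureTower L (L.diffAdjoin (insert y (E : Set L.top)))
  | integral (E : IntermediateField K L.top) (y : L.top) :
      QuadratureTower L E → y′ ∈ E →
      QuadratureTower L (L.diffAdjoin (insert y (E : Set L.top)))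
  | expIntegral (E : IntermediateField K L.top) (y a : L.top) :
      QuadratureTower L E → a ∈ E → y′ = a * y →
      QuadratureTower L (L.diffAdjoin (insert y (E : Set L.top)))

/-- `y ∈ L` is representable by generalized quadratures over `K`. -/
def IsRepresentable (L : Extension K) (y : L.top) : Prop :=
  ∃ E : IntermediateField K L.top, L.QuadratureTower E ∧ y ∈ E

/-- `y = exp z` for a meromorphic function `z` whose derivative is algebraic over `K`. -/
def IsExpOfAlgebraicIntegral (L : Extension K) (y : L.top) : Prop :=
  ∃ (z : L.top.surface → ℂ) (f : L.top),
    L.top.surface.IsMeromorphic z ∧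
    L.top.toFun y = (fun p => Complex.exp (z p) : L.top.surface → ℂ) ∧
    L.top.toFun f = (L.top.surface.derivWrt L.top.x z : L.top.surface → ℂ) ∧
    IsAlgebraic K f

end Extension

/-! ### Linear differential equations -/

/-- The `k`-th derivative. -/
def iterDeriv {F : Type u} [Field F] [Differential F] (k : ℕ) (y : F) : F :=
  (fun z : F => z′)^[k] y

/-- `y` satisfies `y⁽ⁿ⁾ + a₁ y⁽ⁿ⁻¹⁾ + ⋯ + aₙ y = 0`. Only the values `a 1, …, a n` are used. -/
def IsSolution {F : Type u} [Field F] [Differential F] (n : ℕ) (a : ℕ → F) (y : F) : Prop :=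
  iterDeriv n y + ∑ i ∈ Finset.Icc 1 n, a i * iterDeriv (n - i) y = 0

/-- The coefficients `c₁, …, cₙ₋₁` of the equation `u⁽ⁿ⁻¹⁾ + c₁ u⁽ⁿ⁻²⁾ + ⋯ + cₙ₋₁ u = 0` for
`u = (y / y₁)′` that is obtained from `y⁽ⁿ⁾ + a₁ y⁽ⁿ⁻¹⁾ + ⋯ + aₙ y = 0` by substituting
`y = y₁ w`, expanding by the Leibniz rule, dividing by `y₁` and putting `u = w′`. -/
def reducedCoeff {F : Type u} [Field F] [Differential F] (n : ℕ) (a : ℕ → F) (y₁ : F) (i : ℕ) :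
    F :=
  ((n.choose i : F) * iterDeriv i y₁ +
    ∑ m ∈ Finset.Icc 1 i, ((n - m).choose (n - i) : F) * a m * iterDeriv (i - m) y₁) / y₁

/-- The equation `y⁽ⁿ⁾ + a₁ y⁽ⁿ⁻¹⁾ + ⋯ + aₙ y = 0` is solvable by generalized quadratures over
`K`: some extension of `K` contains `n` solutions that are linearly independent over `ℂ` (hence
the whole solution space), and all solutions in it are representable by generalized quadratures
over `K`. -/
def SolvableByQuadratures (K : FunctionalDiffField.{u}) (n : ℕ) (a : ℕ → K) : Prop :=
  ∃ L : Extension K,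
    (∃ v : Fin n → L.top, LinearIndependent ℂ v ∧
      ∀ j, IsSolution n (fun i => algebraMap K L.top (a i)) (v j)) ∧
    ∀ y : L.top, IsSolution n (fun i => algebraMap K L.top (a i)) y → L.IsRepresentable y

end FunctionalDiffField

namespace FunctionalDiffField

/-! ### Linear differential operators and reduction of order -/

section DifferentialAlgebra

variable {F : Type u} [Field F] [Differential F]

/-! Sufficiency is reduction of order read backwards. By `linOp_mul`, if `w₁, …, wₙ₋₁` is a basis of
solutions of the reduced equation and `Iⱼ′ = wⱼ`, then `y₁, y₁ I₁, …, y₁ Iₙ₋₁` is a basis of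
solutions of the original one. The integrals exist after the surface is shrunk to a small connected
open set, and everything is representable over `K` because `y₁` is an exponential of integral of an
algebraic element.

Necessity rests on finding a solution whose logarithmic derivative is algebraic over `K`
(`exists_isSolution_isAlgebraic_logDeriv`). The logarithmic derivative `u` of a representable
solution satisfies a generalized Riccati equation over `K` and lies in the top of a tower of
quadratures. The tower is descended one step at a time
(`QuadratureTower.exists_isAlgebraic_riccati`). Let `A` be the algebraic closure of the lower field
inside an algebraically closed `Ω`, and let `t` be the adjoined element, so that `t′ ∈ A` or `t′ = b
t` with `b ∈ A`. If `t` is algebraic over `A`, then `u ∈ A` already. Otherwise put `s = 1 / t`. In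
both cases `s` divides `s′` in `A[s]`, and one specializes `u` at a place of `A(s, u)` over `s = 0`,
which amounts to taking the constant term of a Puiseux expansion at `t = ∞`. The residue field is
`A`, and the derivation does not decrease orders there (`valuation_deriv_le`,
`exists_differential_place`), so it is compatible with taking residues. At a pole of `u` the term of
top degree of the Riccati expression could not cancel; hence `u` is finite, and its residue in `A`
solves the same Riccati equation (`IsRiccatiSolution.exists_residue`). At the bottom of the tower
this gives a Riccati solution `c` algebraic over `K`.

It remains to return from `c` to a linear solution. The whole solution space lies in `L`, and an
algebraic extension has no new constants, so `c` is the logarithmic derivative of a complex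
combination of the given solutions (`IsRiccatiSolution.exists_isSolution`). This solution lies in
`L`; on a small open set it has a logarithm and becomes the required `y₁`. The solutions `(y / y₁)′`
of the reduced equation are then representable, and they span dimension at least `n - 1`, since only
multiples of `y₁` are killed (`exists_linearIndependent_reduced`). -/

@[simp]
lemma iterDeriv_zero (y : F) : iterDeriv 0 y = y := rfl

lemma iterDeriv_succ (k : ℕ) (y : F) : iterDeriv (k + 1) y = (iterDeriv k y)′ :=
  Function.iterate_succ_apply' _ _ _

lemma iterDeriv_succ' (k : ℕ) (y : F) : iterDeriv (k + 1) y = iterDeriv k y′ :=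
  Function.iterate_succ_apply _ _ _

lemma iterDeriv_add (k : ℕ) (y z : F) : iterDeriv k (y + z) = iterDeriv k y + iterDeriv k z := by
  induction k with
  | zero => rfl
  | succ k ih => simp [iterDeriv_succ, ih]

lemma iterDeriv_const_mul {c : F} (hc : c′ = 0) (k : ℕ) (y : F) :
    iterDeriv k (c * y) = c * iterDeriv k y := by
  induction k with
  | zero => rfl
  | succ k ih => simp [iterDeriv_succ, ih, hc]

lemma iterDeriv_of_zero (k : ℕ) : iterDeriv k (0 : F) = 0 := by
  simpa using iterDeriv_const_mul (F := F) (c := 0) (by simp) k 0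

lemma map_iterDeriv {G : Type u} [Field G] [Differential G] (φ : F →+* G)
    (hφ : ∀ z, φ z′ = (φ z)′) (k : ℕ) (y : F) : φ (iterDeriv k y) = iterDeriv k (φ y) := by
  induction k with
  | zero => rfl
  | succ k ih => simp [iterDeriv_succ, hφ, ih]

/-- The iterated Leibniz rule. -/
lemma iterDeriv_mul (k : ℕ) (y z : F) :
    iterDeriv k (y * z) =
      ∑ j ∈ Finset.range (k + 1), (k.choose j : F) * iterDeriv (k - j) y * iterDeriv j z := by
  have key : iterDeriv k (y * z) = ∑ ij ∈ Finset.HasAntidiagonal.antidiagonal k,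
      (k.choose ij.1 : F) * (iterDeriv ij.2 y * iterDeriv ij.1 z) := by
    induction k with
    | zero => simp
    | succ k ih =>
      have h := Finset.sum_antidiagonal_choose_succ_mul (R := F)
        (fun i j => iterDeriv j y * iterDeriv i z) k
      rw [h, iterDeriv_succ, ih, map_sum, ← Finset.sum_add_distrib]
      refine Finset.sum_congr rfl fun ij hij => ?_
      rw [Nat.choose_symm_of_eq_add (Finset.HasAntidiagonal.mem_antidiagonal.1 hij).symm]
      simp only [Derivation.leibniz, smul_eq_mul, iterDeriv_succ, Derivation.map_natCast]
      ring
  rw [key, Finset.Nat.sum_antidiagonal_eq_sum_range_succ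
    (fun i j => (k.choose i : F) * (iterDeriv j y * iterDeriv i z))]
  exact Finset.sum_congr rfl fun j _ => by ring

/-- The left-hand side `y⁽ⁿ⁾ + a₁ y⁽ⁿ⁻¹⁾ + ⋯ + aₙ y` of a linear differential equation. -/
def linOp (n : ℕ) (a : ℕ → F) (y : F) : F :=
  iterDeriv n y + ∑ i ∈ Finset.Icc 1 n, a i * iterDeriv (n - i) y

lemma isSolution_iff {n : ℕ} {a : ℕ → F} {y : F} : IsSolution n a y ↔ linOp n a y = 0 := Iff.rfl

lemma linOp_add (n : ℕ) (a : ℕ → F) (y z : F) :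
    linOp n a (y + z) = linOp n a y + linOp n a z := by
  simp only [linOp, iterDeriv_add, mul_add, Finset.sum_add_distrib]
  ring

lemma linOp_const_mul (n : ℕ) (a : ℕ → F) {c : F} (hc : c′ = 0) (y : F) :
    linOp n a (c * y) = c * linOp n a y := by
  simp only [linOp, iterDeriv_const_mul hc, mul_add, Finset.mul_sum]
  congr 1
  exact Finset.sum_congr rfl fun _ _ => by ring

lemma IsSolution.map {G : Type u} [Field G] [Differential G] (φ : F →+* G)
    (hφ : ∀ z, φ z′ = (φ z)′) {n : ℕ} {a : ℕ → F} {y : F} (h : IsSolution n a y) :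
    IsSolution n (fun i => φ (a i)) (φ y) := by
  have := congrArg φ h
  simpa [IsSolution, map_iterDeriv φ hφ] using this

lemma IsSolution.of_map {G : Type u} [Field G] [Differential G] (φ : F →+* G)
    (hφ : ∀ z, φ z′ = (φ z)′) {n : ℕ} {a : ℕ → F} {y : F}
    (h : IsSolution n (fun i => φ (a i)) (φ y)) : IsSolution n a y := by
  apply φ.injective
  simpa [IsSolution, map_iterDeriv φ hφ] using h

lemma map_reducedCoeff {G : Type u} [Field G] [Differential G] (φ : F →+* G)
    (hφ : ∀ z, φ z′ = (φ z)′) (n : ℕ) (a : ℕ → F) (y : F) (i : ℕ) :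
    φ (reducedCoeff n a y i) = reducedCoeff n (fun i => φ (a i)) (φ y) i := by
  simp [reducedCoeff, map_iterDeriv φ hφ]

lemma linOp_eq_sum_range {n : ℕ} (a : ℕ → F) (ha : a 0 = 1) (y : F) :
    linOp n a y = ∑ m ∈ Finset.range (n + 1), a m * iterDeriv (n - m) y := by
  rw [linOp, Finset.sum_range_succ', Finset.range_eq_Ico, Finset.sum_Ico_add'
    (fun m => a m * iterDeriv (n - m) y) 0 n 1, add_comm, ha, one_mul]
  rfl

lemma linOp_congr {n : ℕ} {a b : ℕ → F} (h : ∀ i, 1 ≤ i → a i = b i) (y : F) :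
    linOp n a y = linOp n b y := by
  unfold linOp
  congr 1
  exact Finset.sum_congr rfl fun i hi => by rw [h i (Finset.mem_Icc.1 hi).1]

lemma reducedCoeff_zero {n : ℕ} (a : ℕ → F) {y₁ : F} (hy : y₁ ≠ 0) :
    reducedCoeff n a y₁ 0 = 1 := by
  simp [reducedCoeff, hy]

lemma reducedCoeff_congr {n : ℕ} {a b : ℕ → F} (h : ∀ i, 1 ≤ i → a i = b i) (y : F) (i : ℕ) :
    reducedCoeff n a y i = reducedCoeff n b y i := by
  unfold reducedCoeff
  congr 2
  exact Finset.sum_congr rfl fun i hi => by rw [h i (Finset.mem_Icc.1 hi).1]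

lemma mul_reducedCoeff {n i : ℕ} (hi : i ≤ n) (a : ℕ → F) (ha : a 0 = 1) {y₁ : F} (hy : y₁ ≠ 0) :
    y₁ * reducedCoeff n a y₁ i = ∑ m ∈ Finset.range (i + 1),
      ((n - m).choose (n - i) : F) * a m * iterDeriv (i - m) y₁ := by
  rw [reducedCoeff, mul_div_cancel₀ _ hy, Finset.sum_range_succ', Finset.range_eq_Ico,
    Finset.sum_Ico_add' (fun m => ((n - m).choose (n - i) : F) * a m * iterDeriv (i - m) y₁) 0 i 1,
    add_comm, ha]
  simp only [zero_add, mul_one, Nat.sub_zero, Nat.choose_symm hi]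
  rfl

/-- Reduction of order: `P(y₁ w) = y₁ R(w′) + w P(y₁)`. -/
lemma linOp_mul {n : ℕ} (hn : 1 ≤ n) (a : ℕ → F) {y₁ : F} (hy : y₁ ≠ 0) (w : F) :
    linOp n a (y₁ * w) =
      y₁ * linOp (n - 1) (reducedCoeff n a y₁) w′ + w * linOp n a y₁ := by
  -- The value `a 0` enters neither side, so it can be set to `1`; the leading terms then join the
  -- sums.
  wlog ha : a 0 = 1 generalizing a
  · set b : ℕ → F := Function.update a 0 1 with hb
    have hab : ∀ i, 1 ≤ i → a i = b i := fun i hi => by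
      rw [hb, Function.update_of_ne (by omega)]
    rw [linOp_congr hab, linOp_congr hab y₁, this b (by simp [hb]), linOp_congr
      (fun i _ => reducedCoeff_congr hab y₁ i)]
  obtain ⟨n, rfl⟩ : ∃ m, n = m + 1 := ⟨n - 1, by omega⟩
  rw [linOp_eq_sum_range a ha, linOp_eq_sum_range a ha, linOp_eq_sum_range _ (reducedCoeff_zero a hy),
    Nat.add_sub_cancel, ← Finset.sum_range_reflect
      (fun i => reducedCoeff (n + 1) a y₁ i * iterDeriv (n - i) w′), Finset.mul_sum,
    Finset.mul_sum]
  -- The Leibniz sums are padded with vanishing binomials to a range independent of `m`, so that the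
  -- double sum can be regrouped by the order `j` of the derivative of `w`: `j = 0` gives `w P(y₁)`,
  -- and `j = k + 1` gives the coefficient of the `k`-th derivative of `w′`.
  have hL : ∀ m ∈ Finset.range (n + 1 + 1), a m * iterDeriv (n + 1 - m) (y₁ * w) =
      ∑ j ∈ Finset.range (n + 1 + 1), ((n + 1 - m).choose j : F) * a m *
        iterDeriv (n + 1 - m - j) y₁ * iterDeriv j w := by
    intro m hm
    rw [iterDeriv_mul, Finset.mul_sum]
    rw [Finset.sum_subset (Finset.range_subset_range.2 (by omega : n + 1 - m + 1 ≤ n + 1 + 1))]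
    · exact Finset.sum_congr rfl fun j _ => by ring
    · intro j _ hj
      rw [Nat.choose_eq_zero_of_lt (by simp at hj; omega)]
      simp
  rw [Finset.sum_congr rfl hL, Finset.sum_comm, Finset.sum_range_succ']
  congr 1
  · refine Finset.sum_congr rfl fun k hk => ?_
    have hk' : k ≤ n := by simp at hk; omega
    rw [← mul_assoc, mul_reducedCoeff (by omega) a ha hy, iterDeriv_succ', Finset.sum_mul,
      show n - (n + 1 - 1 - k) = k by omega]
    symm
    rw [show n + 1 - 1 - k = n - k by omega]
    rw [Finset.sum_subset (Finset.range_subset_range.2 (by omega : n - k + 1 ≤ n + 1 + 1))]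
    · refine Finset.sum_congr rfl fun m _ => ?_
      rw [show n + 1 - (n - k) = k + 1 by omega, show n - k - m = n + 1 - m - (k + 1) by omega]
    · intro m _ hm
      rw [Nat.choose_eq_zero_of_lt (by simp at hm; omega)]
      simp
  · refine Finset.sum_congr rfl fun m _ => ?_
    simp
    ring

/-- If `y` and `y₁` are solutions, `(y / y₁)′` is a solution of the reduced equation. -/
lemma IsSolution.reduced {n : ℕ} (hn : 1 ≤ n) {a : ℕ → F} {y₁ y : F} (hy : y₁ ≠ 0)
    (h₁ : IsSolution n a y₁) (h : IsSolution n a y) :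
    IsSolution (n - 1) (reducedCoeff n a y₁) (y / y₁)′ := by
  have := linOp_mul hn a hy (y / y₁)
  rw [mul_div_cancel₀ _ hy, isSolution_iff.1 h, isSolution_iff.1 h₁, mul_zero, add_zero] at this
  exact (mul_eq_zero.1 this.symm).resolve_left hy

/-- If `y₁` is a solution and `w′` solves the reduced equation, `y₁ w` is a solution. -/
lemma IsSolution.of_reduced {n : ℕ} (hn : 1 ≤ n) {a : ℕ → F} {y₁ w : F} (hy : y₁ ≠ 0)
    (h₁ : IsSolution n a y₁) (h : IsSolution (n - 1) (reducedCoeff n a y₁) w′) :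
    IsSolution n a (y₁ * w) := by
  rw [isSolution_iff, linOp_mul hn a hy, isSolution_iff.1 h, isSolution_iff.1 h₁]
  simp

/-! ### Solution spaces -/

section Constants

variable {C : Type*} [Field C] [Algebra C F]

/-- The solution space of a linear differential equation. -/
def solutionSpace (hC : ∀ c : C, (algebraMap C F c)′ = 0) (n : ℕ) (a : ℕ → F) :
    Submodule C F where
  carrier := {y | IsSolution n a y}
  add_mem' {y z} hy hz := by
    rw [Set.mem_ofPred_eq, isSolution_iff] at *
    rw [linOp_add, hy, hz, add_zero]
  zero_mem' := by
    rw [Set.mem_ofPred_eq, isSolution_iff]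
    simp [linOp, iterDeriv_of_zero]
  smul_mem' c y hy := by
    rw [Set.mem_ofPred_eq, isSolution_iff] at *
    rw [Algebra.smul_def, linOp_const_mul n a (hC c), hy, mul_zero]

/-- The vector `(y, y′, …, y⁽ⁿ⁻¹⁾)`. -/
def jet (n : ℕ) (y : F) : Fin n → F := fun k => iterDeriv k y

/-- If `q ∈ Fⁿ` satisfies the companion system twisted by `g`, and `q = ∑ λⱼ jet vⱼ` with solutions
`vⱼ` whose jets are independent, then `λⱼ′ = g λⱼ`. -/
lemma deriv_coeff_of_jet_sum {n m : ℕ} {a : ℕ → F} {v : Fin m → F}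
    (hv : ∀ j, IsSolution n a (v j)) (hind : LinearIndependent F fun j => jet n (v j))
    {q : ℕ → F} {g : F} (hq : ∀ k, (q k)′ = q (k + 1) + g * q k)
    (hqn : q n + ∑ i ∈ Finset.Icc 1 n, a i * q (n - i) = 0)
    {l : Fin m → F} (hl : ∀ k < n, q k = ∑ j, l j * iterDeriv k (v j)) (j : Fin m) :
    (l j)′ = g * l j := by
  -- The relation extends to `k = n` because `q` and all `vⱼ` obey the same recursion expressing the
  -- entry of index `n` by the lower ones.
  have hl' : ∀ k ≤ n, q k = ∑ j, l j * iterDeriv k (v j) := by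
    intro k hk
    rcases hk.lt_or_eq with h | rfl
    · exact hl k h
    · rw [eq_neg_of_add_eq_zero_left hqn]
      have : ∀ j, iterDeriv k (v j) = -∑ i ∈ Finset.Icc 1 k, a i * iterDeriv (k - i) (v j) :=
        fun j => eq_neg_of_add_eq_zero_left (hv j)
      simp only [this, mul_neg, Finset.sum_neg_distrib, Finset.mul_sum, neg_inj]
      rw [Finset.sum_comm]
      refine Finset.sum_congr rfl fun i hi => ?_
      rw [hl (k - i) (by simp at hi; omega), Finset.mul_sum]
      exact Finset.sum_congr rfl fun _ _ => by ring
  -- Differentiate the relation for `k < n` and subtract the one for `k + 1`.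
  have key : ∑ j, ((l j)′ - g * l j) • jet n (v j) = 0 := by
    funext k
    have h1 := hq k
    rw [hl' k k.2.le, hl' (k + 1) k.2, map_sum, Finset.mul_sum, ← Finset.sum_add_distrib] at h1
    rw [Finset.sum_apply, Pi.zero_apply, ← sub_eq_zero.2 h1, ← Finset.sum_sub_distrib]
    refine Finset.sum_congr rfl fun j _ => ?_
    simp only [jet, Pi.smul_apply, smul_eq_mul, Derivation.leibniz, iterDeriv_succ]
    ring
  exact sub_eq_zero.1 (Fintype.linearIndependent_iff.1 hind _ key j)

/-- Solutions that are independent over the constants have independent jets. -/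
lemma linearIndependent_jet (hC : ∀ z : F, z′ = 0 → z ∈ Set.range (algebraMap C F)) {n : ℕ}
    {a : ℕ → F} {m : ℕ} {v : Fin m → F} (hv : ∀ j, IsSolution n a (v j))
    (hind : LinearIndependent C v) : LinearIndependent F fun j => jet n (v j) := by
  induction m with
  | zero => exact linearIndependent_empty_type
  | succ m ih =>
    rw [linearIndependent_finSucc] at hind ⊢
    have ih' := ih (v := Fin.tail v) (fun j => hv j.succ) hind.1
    refine ⟨ih', fun hmem => hind.2 ?_⟩
    obtain ⟨l, hl⟩ := (Submodule.mem_span_range_iff_exists_fun F).1 hmem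
    have hl' : ∀ k < n, iterDeriv k (v 0) = ∑ j, l j * iterDeriv k (v (Fin.succ j)) := by
      intro k hk
      have := congrFun hl ⟨k, hk⟩
      simp only [Finset.sum_apply, Pi.smul_apply, smul_eq_mul, jet, Fin.tail] at this
      exact this.symm
    -- With no twist the coefficients of the relation have derivative zero, so a dependence over `F`
    -- is one over the constants.
    have hconst := deriv_coeff_of_jet_sum (q := fun k => iterDeriv k (v 0)) (g := 0)
      (fun j => hv j.succ) ih' (fun k => by simp [iterDeriv_succ]) (hv 0) hl'
    choose c hc using fun j => hC (l j) (by simpa using hconst j)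
    have hv0 : v 0 = ∑ j, l j * v (Fin.succ j) := by
      -- For `n = 0` the jets are empty and say nothing, but the equation itself reads `y = 0`.
      rcases Nat.eq_zero_or_pos n with rfl | hn
      · have h0 : ∀ j, v j = 0 := fun j => by simpa [IsSolution] using hv j
        simp [h0]
      · exact hl' 0 hn
    rw [hv0]
    refine Submodule.sum_mem _ fun j _ => ?_
    rw [← hc, ← Algebra.smul_def]
    exact Submodule.smul_mem _ _ (Submodule.subset_span ⟨j, rfl⟩)

/-- `n` independent solutions of an equation of order `n` span the solution space. -/
lemma mem_span_of_isSolution (hC : ∀ z : F, z′ = 0 → z ∈ Set.range (algebraMap C F)) {n : ℕ}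
    {a : ℕ → F} {v : Fin n → F} (hv : ∀ j, IsSolution n a (v j)) (hind : LinearIndependent C v)
    {y : F} (hy : IsSolution n a y) : y ∈ Submodule.span C (Set.range v) := by
  by_contra hmem
  have hcons : LinearIndependent C (Fin.cons y v : Fin (n + 1) → F) :=
    linearIndependent_finCons.2 ⟨hind, hmem⟩
  have := linearIndependent_jet (n := n) (a := a) hC (v := Fin.cons y v)
    (fun j => by refine Fin.cases ?_ (fun j => ?_) j <;> simp [hy, hv]) hcons
  simpa using this.fintype_card_le_finrank

end Constants

/-! ### The Riccati equation -/

/-- The differential polynomials with `y⁽ᵏ⁾ = riccati (y′ / y) k * y`. -/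
def riccati (u : F) : ℕ → F
  | 0 => 1
  | k + 1 => (riccati u k)′ + u * riccati u k

/-- The generalized Riccati equation satisfied by `y′ / y` for solutions `y`. -/
def IsRiccatiSolution (n : ℕ) (a : ℕ → F) (u : F) : Prop :=
  riccati u n + ∑ i ∈ Finset.Icc 1 n, a i * riccati u (n - i) = 0

lemma iterDeriv_eq_riccati_mul {y u : F} (h : y′ = u * y) (k : ℕ) :
    iterDeriv k y = riccati u k * y := by
  induction k with
  | zero => simp [riccati]
  | succ k ih =>
    simp only [iterDeriv_succ, ih, Derivation.leibniz, smul_eq_mul, h, riccati]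
    ring

/-- Substituting `y⁽ᵏ⁾ = riccati u k * y` makes `y` a common factor of the linear expression. -/
lemma isSolution_iff_isRiccatiSolution {n : ℕ} {a : ℕ → F} {y u : F} (hy : y ≠ 0)
    (h : y′ = u * y) : IsSolution n a y ↔ IsRiccatiSolution n a u := by
  have : linOp n a y = (riccati u n + ∑ i ∈ Finset.Icc 1 n, a i * riccati u (n - i)) * y := by
    simp only [linOp, iterDeriv_eq_riccati_mul h, add_mul, Finset.sum_mul, mul_assoc]
  rw [isSolution_iff, this, IsRiccatiSolution, mul_eq_zero, or_iff_left hy]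

lemma map_riccati {G : Type u} [Field G] [Differential G] (φ : F →+* G)
    (hφ : ∀ z, φ z′ = (φ z)′) (u : F) (k : ℕ) : φ (riccati u k) = riccati (φ u) k := by
  induction k with
  | zero => simp [riccati]
  | succ k ih => simp [riccati, hφ, ih]

lemma IsRiccatiSolution.map {G : Type u} [Field G] [Differential G] (φ : F →+* G)
    (hφ : ∀ z, φ z′ = (φ z)′) {n : ℕ} {a : ℕ → F} {u : F} (h : IsRiccatiSolution n a u) :
    IsRiccatiSolution n (fun i => φ (a i)) (φ u) := by
  have := congrArg φ h
  simpa [IsRiccatiSolution, map_riccati φ hφ] using this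

/-- If the whole solution space lies in `F`, a solution of the Riccati equation in `F` is the
logarithmic derivative of a solution. -/
lemma IsRiccatiSolution.exists_isSolution {C : Type*} [Field C] [Algebra C F]
    (hC : ∀ z : F, z′ = 0 → z ∈ Set.range (algebraMap C F)) {n : ℕ} (hn : 1 ≤ n)
    {a : ℕ → F} {v : Fin n → F} (hv : ∀ j, IsSolution n a (v j)) (hind : LinearIndependent C v)
    {u : F} (hu : IsRiccatiSolution n a u) :
    ∃ y ∈ Submodule.span C (Set.range v), y ≠ 0 ∧ y′ = u * y := by
  have hjet := linearIndependent_jet hC hv hind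
  have htop := hjet.span_eq_top_of_card_eq_finrank' (by simp)
  have hmem : (fun k : Fin n => riccati u k) ∈ Submodule.span F (Set.range fun j => jet n (v j)) :=
    htop ▸ Submodule.mem_top
  obtain ⟨l, hl⟩ := (Submodule.mem_span_range_iff_exists_fun F).1 hmem
  have hl' : ∀ k < n, riccati u k = ∑ j, l j * iterDeriv k (v j) := by
    intro k hk
    have := congrFun hl ⟨k, hk⟩
    simp only [Finset.sum_apply, Pi.smul_apply, smul_eq_mul, jet] at this
    exact this.symm
  -- Formally `riccati u k` is `y⁽ᵏ⁾ / y`, whence the twist by `-u`. All `lⱼ` satisfy `l′ = -u l`,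
  -- so their ratios are constants, and dividing `1 = ∑ lⱼ vⱼ` by a nonzero `lᵢ` exhibits `y = 1 /
  -- lᵢ` as a combination of the `vⱼ` with constant coefficients.
  have hder := deriv_coeff_of_jet_sum (g := -u) hv hjet (fun k => by simp [riccati]) hu hl'
  have hone : (1 : F) = ∑ j, l j * v j := hl' 0 hn
  obtain ⟨i, hi⟩ : ∃ i, l i ≠ 0 := by
    by_contra! h
    simp [h] at hone
  choose c hc using fun j => hC (l j / l i) (by
    rw [Derivation.leibniz_div, hder, hder]
    simp only [smul_eq_mul]
    ring_nf)
  have hy : (l i)⁻¹ = ∑ j, c j • v j := by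
    simp only [Algebra.smul_def, hc]
    rw [← mul_one (l i)⁻¹, hone, Finset.mul_sum]
    exact Finset.sum_congr rfl fun _ _ => by ring
  refine ⟨(l i)⁻¹, ?_, inv_ne_zero hi, ?_⟩
  · rw [hy]
    exact Submodule.sum_mem _ fun j _ =>
      Submodule.smul_mem _ _ (Submodule.subset_span ⟨j, rfl⟩)
  · rw [Derivation.leibniz_inv, hder]
    simp only [smul_eq_mul]
    field_simp

end DifferentialAlgebra
end FunctionalDiffField

namespace FunctionalDiffField

/-! ### Derivations and discrete valuations -/

section DifferentialValuation

variable {A M Γ : Type*} [Field A] [Field M] [Algebra A M] [LinearOrderedCommGroupWithZero Γ]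
  (v : Valuation M Γ)

lemma valuation_algebraMap_eq_one (hA : ∀ a : A, v (algebraMap A M a) ≤ 1) {a : A} (ha : a ≠ 0) :
    v (algebraMap A M a) = 1 := by
  refine le_antisymm (hA a) ?_
  have h := hA a⁻¹
  rw [map_inv₀, map_inv₀] at h
  exact (inv_le_one₀ (zero_lt_iff.2 (by simpa using ha))).1 h

lemma valuation_natCast_eq_one [CharZero A] (hA : ∀ a : A, v (algebraMap A M a) ≤ 1) {k : ℕ} (hk : k ≠ 0) :
    v (k : M) = 1 := by
  rw [← map_natCast (algebraMap A M) k]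
  exact valuation_algebraMap_eq_one v hA (Nat.cast_ne_zero.2 hk)

variable [Differential A] [Differential M] [DifferentialAlgebra A M]

/-- A derivation bounded on the valuation ring is bounded there by `max 1 (v π′)`. -/
lemma valuation_deriv_le_max (hA : ∀ a : A, v (algebraMap A M a) ≤ 1)
    (hres : ∀ x, v x ≤ 1 → ∃ a : A, v (x - algebraMap A M a) < 1) {π : M} (hπ0 : π ≠ 0)
    (hπ1 : v π < 1) (hdisc : ∀ x, v x < 1 → v x ≤ v π)
    (harch : ∀ g : Γ, ∃ k : ℕ, v π ^ k * g ≤ 1) {N : Γ} (hN : ∀ x, v x ≤ 1 → v x′ ≤ N)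
    {x : M} (hx : v x ≤ 1) : v x′ ≤ max 1 (v π′) := by
  have hvπ : 0 < v π := zero_lt_iff.2 (by simpa using hπ0)
  -- Here `y` is the Taylor polynomial of `x` in `π` with coefficients in `A`. Its derivative
  -- involves only derivatives of elements of `A` and `π′`, which gives a bound independent of `k`.
  have hexp : ∀ k : ℕ, ∃ y z : M, x = y + π ^ k * z ∧ v z ≤ 1 ∧ v y′ ≤ max 1 (v π′) := by
    intro k
    induction k with
    | zero => exact ⟨0, x, by simp, hx, by simp⟩
    | succ k ih =>
      obtain ⟨y, z, hxy, hz, hy⟩ := ih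
      obtain ⟨c, hc⟩ := hres z hz
      refine ⟨y + π ^ k * algebraMap A M c, (z - algebraMap A M c) / π, ?_, ?_, ?_⟩
      · rw [hxy]
        field_simp
        ring
      · rw [map_div₀]
        exact div_le_one_of_le₀ (hdisc _ hc) zero_le
      · rw [map_add]
        refine v.map_add_le hy ?_
        rw [Derivation.leibniz, Derivation.leibniz_pow, deriv_algebraMap]
        simp only [smul_eq_mul, nsmul_eq_mul]
        refine v.map_add_le ?_ ?_
        · rw [map_mul, map_pow]
          exact le_max_of_le_left (mul_le_one' (pow_le_one' hπ1.le _) (hA _))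
        · refine le_max_of_le_right ?_
          rw [map_mul, map_mul, map_mul, map_pow, ← map_natCast (algebraMap A M) k]
          calc _ ≤ 1 * (1 * (1 * v π′)) := by
                gcongr
                · exact hA _
                · exact hA _
                · exact pow_le_one' hπ1.le _
            _ = v π′ := by simp
  -- The crude bound `N` serves only for the remainder, where a high power of `π` absorbs it.
  obtain ⟨k, hk⟩ := harch (max N (v π′))
  obtain ⟨y, z, hxy, hz, hy⟩ := hexp (k + 1)
  rw [hxy, map_add]
  refine v.map_add_le hy (le_max_of_le_left ?_)
  rw [Derivation.leibniz, Derivation.leibniz_pow]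
  simp only [smul_eq_mul, nsmul_eq_mul, Nat.add_sub_cancel]
  refine v.map_add_le ?_ ?_
  · rw [map_mul, map_pow, pow_succ]
    calc v π ^ k * v π * v z′ ≤ v π ^ k * 1 * max N (v π′) := by
          gcongr
          exact (hN z hz).trans (le_max_left _ _)
      _ ≤ 1 := by simpa using hk
  · rw [map_mul, map_mul, map_mul, map_pow, ← map_natCast (algebraMap A M) (k + 1)]
    calc _ ≤ 1 * (1 * (v π ^ k * max N (v π′))) := by
          gcongr
          · exact hA _
          · exact le_max_right _ _
      _ ≤ 1 := by simpa using hk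

/-- Over a discrete valuation with residue field `A`, a bounded derivation that does not decrease
the order of one element of positive order does not decrease any order. -/
lemma valuation_deriv_le [CharZero A] (hA : ∀ a : A, v (algebraMap A M a) ≤ 1)
    (hres : ∀ x, v x ≤ 1 → ∃ a : A, v (x - algebraMap A M a) < 1) {π : M} (hπ0 : π ≠ 0)
    (hπ1 : v π < 1) (hdisc : ∀ x, v x < 1 → v x ≤ v π)
    (hunif : ∀ x, x ≠ 0 → v x ≤ 1 → ∃ k : ℕ, v x = v π ^ k)
    (harch : ∀ g : Γ, ∃ k : ℕ, v π ^ k * g ≤ 1) {N : Γ} (hN : ∀ x, v x ≤ 1 → v x′ ≤ N)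
    {s : M} (hs0 : s ≠ 0) (hs1 : v s < 1) (hs : v s′ ≤ v s) (x : M) : v x′ ≤ v x := by
  have hvπ : 0 < v π := zero_lt_iff.2 (by simpa using hπ0)
  have hmax := fun {x} => valuation_deriv_le_max v hA hres hπ0 hπ1 hdisc harch hN (x := x)
  -- If `π′` had smaller order than `π`, discreteness would make that order at most zero. Write `s =
  -- π ^ (e + 1) ε` with a unit `ε`. The term `(e + 1) ε π ^ e π′` then strictly dominates `s′`,
  -- because `e + 1` is a unit in characteristic zero, and `s′` would have smaller order than `s`.
  have hπ' : v π′ ≤ v π := by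
    by_contra! hlt
    have h1 : 1 ≤ v π′ := by
      by_contra! h
      exact absurd (hdisc _ h) (not_le.2 hlt)
    rw [max_eq_right h1] at hmax
    obtain ⟨e, he⟩ := hunif s hs0 hs1.le
    have he0 : e ≠ 0 := by
      rintro rfl
      simp [he] at hs1
    obtain ⟨e, rfl⟩ := Nat.exists_eq_succ_of_ne_zero he0
    set ε := s / π ^ (e + 1) with hε
    have hsε : s = π ^ (e + 1) * ε := by
      rw [hε]
      field_simp
    have hvε : v ε = 1 := by
      rw [hε, map_div₀, he, map_pow, div_self (pow_ne_zero _ hvπ.ne')]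
    have h2 : v (π ^ (e + 1) * ε′) < v (ε * ((e + 1 : ℕ) * (π ^ e * π′))) := by
      rw [map_mul, map_mul, map_mul, map_mul, hvε, valuation_natCast_eq_one v hA (Nat.succ_ne_zero e),
        one_mul, one_mul, map_pow, map_pow, pow_succ]
      calc v π ^ e * v π * v ε′ ≤ v π ^ e * v π * v π′ := by
            gcongr
            exact hmax hvε.le
        _ < v π ^ e * v π′ := by
          rw [mul_assoc]
          refine mul_lt_mul_of_pos_left ?_ (pow_pos hvπ e)
          exact mul_lt_of_lt_one_left (zero_lt_one.trans_le h1) hπ1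
    have h3 : s′ = π ^ (e + 1) * ε′ + ε * ((e + 1 : ℕ) * (π ^ e * π′)) := by
      rw [hsε, Derivation.leibniz, Derivation.leibniz_pow]
      simp only [smul_eq_mul, nsmul_eq_mul, Nat.add_sub_cancel]
    rw [h3, Valuation.map_add_eq_of_lt_right v h2, he, map_mul, map_mul, map_mul, hvε,
      valuation_natCast_eq_one v hA (Nat.succ_ne_zero e), one_mul, one_mul, map_pow, pow_succ] at hs
    exact absurd (le_of_mul_le_mul_left hs (pow_pos hvπ e)) (not_le.2 hlt)
  rw [max_eq_left (hπ'.trans hπ1.le)] at hmax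
  have hbound : ∀ x, v x ≤ 1 → v x′ ≤ v x := by
    intro x hx
    rcases eq_or_ne x 0 with rfl | hx0
    · simp
    obtain ⟨k, hk⟩ := hunif x hx0 hx
    set ε := x / π ^ k with hε
    have hxε : x = π ^ k * ε := by
      rw [hε]
      field_simp
    have hvε : v ε = 1 := by
      rw [hε, map_div₀, hk, map_pow, div_self (pow_ne_zero _ hvπ.ne')]
    rw [hk, hxε, Derivation.leibniz, Derivation.leibniz_pow]
    simp only [smul_eq_mul, nsmul_eq_mul]
    refine v.map_add_le ?_ ?_
    · rw [map_mul, map_pow]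
      exact mul_le_of_le_one_right' (hmax hvε.le)
    · rw [map_mul, hvε, one_mul, map_mul, map_mul, map_pow, ← map_natCast (algebraMap A M) k]
      rcases k with _ | k
      · simp
      · rw [Nat.add_sub_cancel, pow_succ]
        calc _ ≤ 1 * (v π ^ k * v π) := by
              gcongr
              exact hA _
          _ = _ := one_mul _
  rcases le_total (v x) 1 with h | h
  · exact hbound x h
  · have hx0 : x ≠ 0 := by
      rintro rfl
      simp at h
    -- Poles reduce to zeros through `(1 / x)′ = -x′ / x²`.
    have h1 : v x⁻¹ ≤ 1 := by
      rw [map_inv₀]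
      exact inv_le_one_of_one_le₀ h
    have h2 := hbound _ h1
    rw [Derivation.leibniz_inv, smul_eq_mul, map_mul, Valuation.map_neg, map_pow, map_inv₀] at h2
    have hvx : 0 < v x := zero_lt_one.trans_le h
    rw [inv_pow, inv_mul_le_iff₀ (pow_pos hvx 2)] at h2
    calc v x′ ≤ v x ^ 2 * (v x)⁻¹ := h2
      _ = v x := by rw [pow_two, mul_assoc, mul_inv_cancel₀ hvx.ne', mul_one]

end DifferentialValuation

/-! ### Specializing Riccati solutions to the residue field -/

section RiccatiValuation

variable {A M : Type u} {Γ : Type*} [Field A] [Differential A] [Field M] [Differential M]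
  [Algebra A M] [DifferentialAlgebra A M] [LinearOrderedCommGroupWithZero Γ] (v : Valuation M Γ)

/-- At a pole of `u`, multiplication by `u` outweighs differentiation, so `uᵏ` is the dominant term
of the `k`-th Riccati polynomial. -/
lemma valuation_riccati (hder : ∀ x, v x′ ≤ v x) {u : M} (hu : 1 < v u) (k : ℕ) :
    v (riccati u k) = v u ^ k := by
  have hu0 : 0 < v u := zero_lt_one.trans hu
  induction k with
  | zero => simp [riccati]
  | succ k ih =>
    have h : v (riccati u k)′ < v (u * riccati u k) := by
      rw [map_mul, ih]
      calc _ ≤ v u ^ k := (hder _).trans ih.le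
        _ < v u * v u ^ k := lt_mul_of_one_lt_left (pow_pos hu0 k) hu
    rw [riccati, Valuation.map_add_eq_of_lt_right v h, map_mul, ih, pow_succ']

/-- A derivation that does not decrease orders maps the maximal ideal into itself, so differential
polynomials respect congruence modulo it. -/
lemma valuation_riccati_sub_lt_one (hder : ∀ x, v x′ ≤ v x) {u c : M} (hc : v c ≤ 1)
    (huc : v (u - c) < 1) (k : ℕ) :
    v (riccati c k) ≤ 1 ∧ v (riccati u k - riccati c k) < 1 := by
  induction k with
  | zero => simp [riccati]
  | succ k ih =>
    refine ⟨v.map_add_le ((hder _).trans ih.1) ?_, ?_⟩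
    · rw [map_mul]
      exact mul_le_one' hc ih.1
    · have : riccati u (k + 1) - riccati c (k + 1) =
          (riccati u k - riccati c k)′ + ((u - c) * (riccati u k - riccati c k) +
            ((u - c) * riccati c k + c * (riccati u k - riccati c k))) := by
        simp only [riccati, map_sub]
        ring
      rw [this]
      refine v.map_add_lt ((hder _).trans_lt ih.2) (v.map_add_lt ?_ (v.map_add_lt ?_ ?_))
      · rw [map_mul]
        exact mul_lt_one' huc ih.2
      · rw [map_mul]
        exact mul_lt_one_of_lt_of_le huc ih.1
      · rw [map_mul]
        exact mul_lt_one_of_nonneg_of_lt_one_right hc zero_le ih.2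

/-- A solution of the Riccati equation specializes to the residue field. -/
lemma IsRiccatiSolution.exists_residue (hA : ∀ a : A, v (algebraMap A M a) ≤ 1)
    (hres : ∀ x, v x ≤ 1 → ∃ a : A, v (x - algebraMap A M a) < 1)
    (hder : ∀ x, v x′ ≤ v x) {n : ℕ} {a : ℕ → A} {u : M}
    (hu : IsRiccatiSolution n (fun i => algebraMap A M (a i)) u) :
    ∃ c : A, IsRiccatiSolution n a c := by
  have hu1 : v u ≤ 1 := by
    by_contra! h
    have hu0 : 0 < v u := zero_lt_one.trans h
    have h1 := eq_neg_of_add_eq_zero_left hu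
    have h2 : v (∑ i ∈ Finset.Icc 1 n, algebraMap A M (a i) * riccati u (n - i)) < v u ^ n := by
      refine v.map_sum_lt (pow_pos hu0 n).ne' fun i hi => ?_
      rw [map_mul, valuation_riccati v hder h]
      simp only [Finset.mem_Icc] at hi
      calc _ ≤ 1 * v u ^ (n - i) := by
            gcongr
            exact hA _
        _ < v u ^ n := by
          rw [one_mul]
          exact pow_lt_pow_right₀ h (by omega)
    rw [← valuation_riccati v hder h n, h1, Valuation.map_neg] at h2
    exact lt_irrefl _ h2
  obtain ⟨c, hc⟩ := hres u hu1
  refine ⟨c, ?_⟩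
  -- The Riccati expression at `c` is congruent to the one at `u`, which is zero; but a nonzero
  -- element of `A` is a unit at the place.
  by_contra hne
  have hR := valuation_riccati_sub_lt_one v hder (hA c) hc
  have h1 := valuation_algebraMap_eq_one (M := M) v hA (a := riccati c n +
    ∑ i ∈ Finset.Icc 1 n, a i * riccati c (n - i)) hne
  have h2 : algebraMap A M (riccati c n + ∑ i ∈ Finset.Icc 1 n, a i * riccati c (n - i)) =
      -((riccati u n - riccati (algebraMap A M c) n) + ∑ i ∈ Finset.Icc 1 n,
        algebraMap A M (a i) * (riccati u (n - i) - riccati (algebraMap A M c) (n - i))) := by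
    have hmap := map_riccati (algebraMap A M) (fun z => (deriv_algebraMap z).symm) c
    simp only [map_add, map_sum, map_mul, hmap, mul_sub, Finset.sum_sub_distrib]
    have := hu
    unfold IsRiccatiSolution at this
    linear_combination this
  rw [h2, Valuation.map_neg] at h1
  refine absurd h1 (ne_of_lt ?_)
  refine v.map_add_lt (hR n).2 (v.map_sum_lt one_ne_zero fun i _ => ?_)
  rw [map_mul]
  exact mul_lt_one_of_nonneg_of_lt_one_right (hA _) zero_le (hR _).2

end RiccatiValuation

end FunctionalDiffField

namespace FunctionalDiffField

/-! ### A differential place over `s = 0` -/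

section Place

open Polynomial WithZero IsDedekindDomain

/-- Discreteness of the value group, in the form of the four conditions on the uniformizer required
by `valuation_deriv_le`. -/
lemma exp_neg_one_facts {M : Type*} [Field M] (v : Valuation M (WithZero (Multiplicative ℤ)))
    {π : M} (hπ : v π = exp (-1 : ℤ)) :
    v π < 1 ∧ (∀ x, v x < 1 → v x ≤ v π) ∧ (∀ x, x ≠ 0 → v x ≤ 1 → ∃ k : ℕ, v x = v π ^ k) ∧
      ∀ g : WithZero (Multiplicative ℤ), ∃ k : ℕ, v π ^ k * g ≤ 1 := by
  have hlog : ∀ x, x ≠ 0 → v x = exp (log (v x)) := fun x hx =>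
    (exp_log (by simpa using hx)).symm
  refine ⟨?_, fun x hx => ?_, fun x hx0 hx => ?_, fun g => ?_⟩
  · rw [hπ, ← exp_zero, exp_lt_exp]
    omega
  · rcases eq_or_ne x 0 with rfl | hx0
    · simp
    · rw [hlog x hx0, ← exp_zero, exp_lt_exp] at hx
      rw [hlog x hx0, hπ, exp_le_exp]
      omega
  · rw [hlog x hx0, ← exp_zero, exp_le_exp] at hx
    refine ⟨(-log (v x)).toNat, ?_⟩
    rw [hπ, ← exp_nsmul, hlog x hx0, exp_inj]
    simp only [log_exp, nsmul_eq_mul]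
    omega
  · rcases eq_or_ne g 0 with rfl | hg
    · exact ⟨0, by simp⟩
    · refine ⟨(log g).toNat, ?_⟩
      rw [hπ, ← exp_nsmul, ← exp_log hg, ← exp_add, ← exp_zero, exp_le_exp]
      simp only [nsmul_eq_mul, log_exp]
      omega

/-- A finite extension `M` of `A(s)`, with `A` algebraically closed, has a place over `s = 0` with
residue field `A`; if `s ∣ s′` in `A[s]`, the derivation does not decrease orders there. -/
lemma exists_differential_place (A K₀ M : Type*) [Field A] [IsAlgClosed A] [CharZero A]
    [Field K₀] [Field M] [Differential A] [Differential M] [Algebra A M] [DifferentialAlgebra A M]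
    [Algebra A[X] M] [IsScalarTower A A[X] M] [Algebra A[X] K₀] [IsFractionRing A[X] K₀]
    [Algebra K₀ M] [IsScalarTower A[X] K₀ M] [FiniteDimensional K₀ M] (q : A[X])
    (hq : (algebraMap A[X] M X)′ = algebraMap A[X] M (X * q)) :
    ∃ v : Valuation M (WithZero (Multiplicative ℤ)), (∀ a : A, v (algebraMap A M a) ≤ 1) ∧
      (∀ x, v x ≤ 1 → ∃ a : A, v (x - algebraMap A M a) < 1) ∧ ∀ x, v x′ ≤ v x := by
  have : CharZero A[X] := inferInstance
  have : CharZero K₀ := charZero_of_injective_algebraMap (IsFractionRing.injective A[X] K₀)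
  let B := integralClosure A[X] M
  have hDed : IsDedekindDomain B := integralClosure.isDedekindDomain A[X] K₀ M
  have hFrac : IsFractionRing B M := integralClosure.isFractionRing_of_finite_extension K₀ M
  have hFin : Module.Finite A[X] B := IsIntegralClosure.finite A[X] K₀ M B
  have hinj : Function.Injective (algebraMap A[X] M) := by
    rw [IsScalarTower.algebraMap_eq A[X] K₀ M]
    exact (algebraMap K₀ M).injective.comp (IsFractionRing.injective A[X] K₀)
  have hinjB : Function.Injective (algebraMap A[X] B) := by
    refine Function.Injective.of_comp (f := algebraMap B M) ?_
    rw [← RingHom.coe_comp, ← IsScalarTower.algebraMap_eq A[X] B M]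
    exact hinj
  have : FaithfulSMul A[X] B := (faithfulSMul_iff_algebraMap_injective _ _).2 hinjB
  have hX : (Ideal.span {(X : A[X])}).IsMaximal :=
    PrincipalIdealRing.isMaximal_of_irreducible irreducible_X
  obtain ⟨Q, hQ, hlies⟩ := Ideal.exists_maximal_ideal_liesOver_of_isIntegral (S := B)
    (Ideal.span {(X : A[X])})
  have hXQ : algebraMap A[X] B X ∈ Q :=
    (Ideal.mem_of_liesOver Q (Ideal.span {(X : A[X])}) X).1 (Ideal.mem_span_singleton_self X)
  have hX0 : algebraMap A[X] B X ≠ 0 := fun h => X_ne_zero (hinjB (by rw [h, map_zero]))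
  let P : HeightOneSpectrum B := ⟨Q, hQ.isPrime, fun h => hX0 (by rwa [h, Ideal.mem_bot] at hXQ)⟩
  set v := P.valuation M with hv
  have hvB : ∀ b : B, v (algebraMap B M b) ≤ 1 := fun b => P.valuation_le_one b
  have hvR : ∀ r : A[X], v (algebraMap A[X] M r) ≤ 1 := fun r => by
    rw [IsScalarTower.algebraMap_apply A[X] B M]
    exact hvB _
  have hA : ∀ a : A, v (algebraMap A M a) ≤ 1 := fun a => by
    rw [IsScalarTower.algebraMap_apply A A[X] M]
    exact hvR _
  have hresB : ∀ b : B, ∃ a : A, v (algebraMap B M b - algebraMap A M a) < 1 := by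
    -- Since `X ∈ Q`, the integral map from `A[X]` to `B ⧸ Q` factors through evaluation at `0`. The
    -- residue field is therefore integral over the algebraically closed field `A`, hence equal to
    -- it.
    let g : A →+* B ⧸ Q := (Ideal.Quotient.mk Q).comp ((algebraMap A[X] B).comp C)
    have hg : g.IsIntegral := by
      refine RingHom.IsIntegral.tower_top (Polynomial.evalRingHom (0 : A)) g ?_
      have : g.comp (Polynomial.evalRingHom (0 : A)) =
          (Ideal.Quotient.mk Q).comp (algebraMap A[X] B) := by
        refine Polynomial.ringHom_ext (fun a => by simp [g]) ?_
        simp only [RingHom.comp_apply, coe_evalRingHom, eval_X, map_zero]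
        exact (Ideal.Quotient.eq_zero_iff_mem.2 hXQ).symm
      rw [this]
      exact RingHom.IsIntegral.trans _ _
        (algebraMap_isIntegral_iff.2 inferInstance)
        (RingHom.isIntegral_of_surjective _ Ideal.Quotient.mk_surjective)
    let _ : Algebra A (B ⧸ Q) := g.toAlgebra
    have : Algebra.IsIntegral A (B ⧸ Q) := algebraMap_isIntegral_iff.1 hg
    intro b
    obtain ⟨a, ha⟩ := (IsAlgClosed.algebraMap_bijective_of_isIntegral
      (k := A) (K := B ⧸ Q)).2 (Ideal.Quotient.mk Q b)
    refine ⟨a, ?_⟩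
    have h1 : b - algebraMap A[X] B (C a) ∈ Q := by
      rw [← Ideal.Quotient.eq_zero_iff_mem, map_sub, sub_eq_zero]
      exact ha.symm
    have h2 : v (algebraMap B M (b - algebraMap A[X] B (C a))) < 1 :=
      (P.valuation_lt_one_iff_mem _).2 h1
    rw [map_sub, ← IsScalarTower.algebraMap_apply A[X] B M] at h2
    rwa [IsScalarTower.algebraMap_apply A A[X] M]
  have hprime : ∀ d : P.asIdeal.primeCompl, v (algebraMap B M d) = 1 := fun d => by
    rw [hv, P.valuation_of_algebraMap]
    exact (P.intValuation_eq_one_iff_mem_primeCompl _).2 d.2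
  have hres : ∀ x, v x ≤ 1 → ∃ a : A, v (x - algebraMap A M a) < 1 := by
    intro x hx
    obtain ⟨b, d, hbd⟩ := P.exists_primeCompl_mul_eq_of_integer x hx
    have hd := hprime d
    obtain ⟨β, hβ⟩ := hresB b
    obtain ⟨δ, hδ⟩ := hresB d
    have hd0 : algebraMap B M d ≠ 0 := fun h => by simp [h] at hd
    have hδ0 : δ ≠ 0 := by
      rintro rfl
      rw [map_zero, sub_zero, hd] at hδ
      exact lt_irrefl _ hδ
    have hδ1 := valuation_algebraMap_eq_one v hA hδ0
    have hδM : algebraMap A M δ ≠ 0 := fun h => by simp [h] at hδ1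
    refine ⟨β / δ, ?_⟩
    have hx' : x - algebraMap A M (β / δ) = ((algebraMap B M b - algebraMap A M β) -
        algebraMap A M (β / δ) * (algebraMap B M d - algebraMap A M δ)) / algebraMap B M d := by
      rw [← hbd, map_div₀]
      field_simp
      ring
    rw [hx', map_div₀, hd, div_one]
    refine v.map_sub_lt hβ ?_
    rw [map_mul]
    exact mul_lt_one_of_nonneg_of_lt_one_right (hA _) zero_le hδ
  have hRaeval : ∀ r : A[X], algebraMap A[X] M r = aeval (algebraMap A[X] M X) r := fun r => by
    rw [aeval_algebraMap_apply, aeval_X_left_apply]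
  -- As `s′` is a polynomial in `s`, the derivation preserves the image of `A[X]`.
  have hderR : ∀ r : A[X], v (algebraMap A[X] M r)′ ≤ 1 := by
    intro r
    rw [hRaeval, Differential.deriv_aeval_eq_implicitDeriv _ (X * q) (by rw [hq, hRaeval]),
      ← hRaeval]
    exact hvR _
  obtain ⟨S, hS⟩ := hFin.fg_top
  -- The derivation need not preserve `B`, but `B` is finite over `A[X]`, so the derivatives of
  -- finitely many generators bound it on `B`, and then on the whole valuation ring by clearing
  -- denominators that are units at `P`.
  obtain ⟨N, hN1, hN⟩ : ∃ N : WithZero (Multiplicative ℤ), 1 ≤ N ∧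
      ∀ b ∈ S, v (algebraMap B M b)′ ≤ N := by
    refine ⟨S.sup (fun b => v (algebraMap B M b)′) ⊔ 1, le_sup_right, fun b hb => ?_⟩
    exact (Finset.le_sup (f := fun b => v (algebraMap B M b)′) hb).trans le_sup_left
  have hderB : ∀ b : B, v (algebraMap B M b)′ ≤ N := by
    intro b
    have hb : b ∈ Submodule.span A[X] (S : Set B) := hS ▸ Submodule.mem_top
    induction hb using Submodule.span_induction with
    | mem b hb => exact hN b hb
    | zero => simp
    | add b c _ _ hb hc =>
      rw [map_add, map_add]
      exact v.map_add_le hb hc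
    | smul r b _ hb =>
      rw [Algebra.smul_def, map_mul, ← IsScalarTower.algebraMap_apply A[X] B M, Derivation.leibniz]
      simp only [smul_eq_mul]
      refine v.map_add_le ?_ ?_
      · rw [map_mul]
        exact mul_le_of_le_one_of_le (hvR r) hb
      · rw [map_mul]
        exact (mul_le_one' (hvB b) (hderR r)).trans hN1
  have hbd : ∀ x, v x ≤ 1 → v x′ ≤ N := by
    intro x hx
    obtain ⟨b, d, hbd⟩ := P.exists_primeCompl_mul_eq_of_integer x hx
    have hd := hprime d
    have h1 : x′ * algebraMap B M d =
        (algebraMap B M b)′ - x * (algebraMap B M d)′ := by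
      rw [← hbd, Derivation.leibniz]
      simp only [smul_eq_mul]
      ring
    have h2 : v x′ = v (x′ * algebraMap B M d) := by rw [map_mul, hd, mul_one]
    rw [h2, h1]
    refine v.map_sub_le (hderB b) ?_
    rw [map_mul]
    exact mul_le_of_le_one_of_le hx (hderB _)
  obtain ⟨π, hπ⟩ := P.valuation_exists_uniformizer M
  obtain ⟨h1, h2, h3, h4⟩ := exp_neg_one_facts v hπ
  have hπ0 : π ≠ 0 := by
    rintro rfl
    rw [map_zero] at hπ
    exact exp_ne_zero hπ.symm
  refine ⟨v, hA, hres, valuation_deriv_le v hA hres hπ0 h1 h2 h3 h4 hbd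
    (s := algebraMap A[X] M X) ?_ ?_ ?_⟩
  · exact fun h => X_ne_zero (hinj (by rw [h, map_zero]))
  · rw [IsScalarTower.algebraMap_apply A[X] B M]
    exact (P.valuation_lt_one_iff_mem _).2 hXQ
  · rw [hq, map_mul, map_mul]
    exact mul_le_of_le_one_right' (hvR q)

end Place

/-! ### Differential subfields, algebraic extensions and their constants -/

section Stable

variable {F Ω : Type*} [Field F] [Field Ω] [Algebra F Ω] [Differential Ω]

/-- The derivation on an intermediate field that is stable under the derivation. -/
@[reducible]
def differentialOfStable (E : IntermediateField F Ω) (h : ∀ z ∈ E, z′ ∈ E) : Differential E where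
  deriv := Derivation.mk'
    (AddMonoidHom.toIntLinearMap
      { toFun := fun z => ⟨(z : Ω)′, h z z.2⟩
        map_zero' := by ext; simp
        map_add' := fun y z => by ext; simp })
    (fun y z => by ext; simp)

lemma differentialAlgebra_of_stable (E : IntermediateField F Ω) (h : ∀ z ∈ E, z′ ∈ E) :
    letI := differentialOfStable E h
    DifferentialAlgebra E Ω :=
  letI := differentialOfStable E h
  ⟨fun _ => rfl⟩

lemma deriv_mem_adjoin [Differential F] [DifferentialAlgebra F Ω] {S : Set Ω}
    (hS : ∀ z ∈ S, z′ ∈ IntermediateField.adjoin F S) {z : Ω}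
    (hz : z ∈ IntermediateField.adjoin F S) : z′ ∈ IntermediateField.adjoin F S := by
  induction hz using IntermediateField.adjoin_induction with
  | mem z hz => exact hS z hz
  | algebraMap z =>
    rw [deriv_algebraMap]
    exact IntermediateField.algebraMap_mem _ _
  | add y z _ _ hy hz =>
    rw [map_add]
    exact add_mem hy hz
  | inv z hz hz' =>
    rw [Derivation.leibniz_inv]
    exact mul_mem (neg_mem (pow_mem (inv_mem hz) 2)) hz'
  | mul y z hy hz hy' hz' =>
    rw [Derivation.leibniz]
    exact add_mem (mul_mem hy hz') (mul_mem hz hy')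

variable [Differential F] [DifferentialAlgebra F Ω] [CharZero F]

/-- The derivative of an algebraic element lies in the field it generates. -/
lemma deriv_mem_adjoin_of_isAlgebraic {z : Ω} (hz : IsAlgebraic F z) :
    z′ ∈ IntermediateField.adjoin F {z} := by
  have : FiniteDimensional F (IntermediateField.adjoin F {z}) :=
    IntermediateField.adjoin.finiteDimensional hz.isIntegral
  -- A finite extension carries its own derivation extending that of `F`, and the inclusion into `Ω`
  -- respects it.
  have h := deriv_algebraMap (B := Ω) (IntermediateField.AdjoinSimple.gen F z)
  rw [IntermediateField.AdjoinSimple.algebraMap_gen] at h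
  rw [h]
  exact SetLike.coe_mem _

lemma isAlgebraic_deriv {z : Ω} (hz : IsAlgebraic F z) : IsAlgebraic F z′ := by
  have : FiniteDimensional F (IntermediateField.adjoin F {z}) :=
    IntermediateField.adjoin.finiteDimensional hz.isIntegral
  have h : IsAlgebraic F (⟨z′, deriv_mem_adjoin_of_isAlgebraic hz⟩ :
    IntermediateField.adjoin F {z}) := Algebra.IsAlgebraic.isAlgebraic _
  exact h.algebraMap (A := Ω)

end Stable

section AlgebraicClosure

variable (F Ω : Type*) [Field F] [Differential F] [CharZero F] [Field Ω] [Algebra F Ω]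
  [Algebra.IsAlgebraic F Ω]

open TensorProduct KaehlerDifferential in
/-- The extension of a derivation to an algebraic extension. -/
@[reducible]
noncomputable def differentialOfIsAlgebraic : Differential Ω where
  deriv :=
    -- Algebraic extensions in characteristic zero are formally étale, so the differentials of `Ω`
    -- are the base change of those of `F`, and a derivation of `F` extends linearly.
    have : Algebra.FormallyEtale F Ω := Algebra.FormallyEtale.of_isSeparable F Ω
    (((Derivation.liftKaehlerDifferential
      ((Algebra.linearMap F Ω).compDer (Differential.deriv (R := F)))).liftBaseChange Ω).comp
        (tensorKaehlerEquivOfFormallyEtale ℤ F Ω).symm.toLinearMap).compDer (D ℤ Ω)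

lemma differentialAlgebra_of_isAlgebraic :
    letI := differentialOfIsAlgebraic F Ω
    DifferentialAlgebra F Ω := by
  let _ := differentialOfIsAlgebraic F Ω
  refine ⟨fun a => ?_⟩
  have : Algebra.FormallyEtale F Ω := Algebra.FormallyEtale.of_isSeparable F Ω
  change LinearMap.liftBaseChange Ω _ ((KaehlerDifferential.tensorKaehlerEquivOfFormallyEtale
    ℤ F Ω).symm (KaehlerDifferential.D ℤ Ω (algebraMap F Ω a))) = _
  rw [KaehlerDifferential.tensorKaehlerEquivOfFormallyEtale_symm_D_algebraMap]
  simp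

end AlgebraicClosure

section Constants

/-- An element algebraic over an algebraically closed field belongs to it. -/
lemma mem_range_algebraMap_of_isAlgebraic {C Ω : Type*} [Field C] [IsAlgClosed C] [Field Ω]
    [Algebra C Ω] {z : Ω} (hz : IsAlgebraic C z) : z ∈ Set.range (algebraMap C Ω) := by
  have : FiniteDimensional C (IntermediateField.adjoin C {z}) :=
    IntermediateField.adjoin.finiteDimensional hz.isIntegral
  have h := IntermediateField.eq_bot_of_isAlgClosed_of_isAlgebraic
    (IntermediateField.adjoin C {z})
  have hmem := IntermediateField.mem_adjoin_simple_self C z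
  rw [h] at hmem
  exact IntermediateField.mem_bot.1 hmem

/-- An algebraic extension has no new constants if the constants are algebraically closed. -/
lemma mem_range_of_deriv_eq_zero_of_isAlgebraic {F Ω : Type*} [Field F] [Differential F] [Field Ω]
    [Algebra F Ω] [Algebra.IsAlgebraic F Ω] [Differential Ω] [DifferentialAlgebra F Ω]
    {C : Type*} [Field C] [IsAlgClosed C] [Algebra C F] [Algebra C Ω] [IsScalarTower C F Ω]
    (hC : ∀ z : F, z′ = 0 → z ∈ Set.range (algebraMap C F)) {z : Ω} (hz : z′ = 0) :
    z ∈ Set.range (algebraMap C Ω) := by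
  have hbound : IsIntegral F z := Algebra.IsIntegral.isIntegral z
  have hmonic := minpoly.monic hbound
  set p := minpoly F z with hp
  -- Differentiating `p(z) = 0` with `z′ = 0` shows that `z` is also a root of the polynomial of
  -- differentiated coefficients. This has lower degree because `p` is monic, so it vanishes: `p`
  -- has constant coefficients and `z` is algebraic over `C`.
  have h1 := Differential.deriv_aeval_eq z p
  rw [minpoly.aeval, hz, mul_zero, add_zero, map_zero] at h1
  have h2 : Differential.mapCoeffs p = 0 := by
    by_contra hne
    refine absurd (minpoly.degree_le_of_ne_zero F z hne h1.symm) (not_le.2 ?_)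
    rw [← hp, Polynomial.degree_eq_natDegree hmonic.ne_zero]
    refine (Polynomial.degree_lt_iff_coeff_zero _ _).2 fun m hm => ?_
    rw [Differential.coeff_mapCoeffs]
    rcases hm.lt_or_eq with h | rfl
    · rw [Polynomial.coeff_eq_zero_of_natDegree_lt h, map_zero]
    · rw [hmonic.coeff_natDegree, Derivation.map_one_eq_zero]
  have h3 : p ∈ Polynomial.lifts (algebraMap C F) := by
    refine (Polynomial.lifts_iff_coeff_lifts p).2 fun k => hC _ ?_
    rw [← Differential.coeff_mapCoeffs, h2, Polynomial.coeff_zero]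
  obtain ⟨q, hq⟩ := (Polynomial.mem_lifts p).1 h3
  refine mem_range_algebraMap_of_isAlgebraic ⟨q, ?_, ?_⟩
  · rintro rfl
    exact hmonic.ne_zero (by rw [← hq, Polynomial.map_zero])
  · rw [← Polynomial.aeval_map_algebraMap F, hq, hp, minpoly.aeval]

end Constants

/-! ### Descending a Riccati solution through one quadrature -/

section RiccatiStep

open Polynomial IntermediateField

variable {A Ω : Type u} [Field A] [IsAlgClosed A] [CharZero A] [Differential A] [Field Ω]
  [Differential Ω] [Algebra A Ω] [DifferentialAlgebra A Ω]

/-- If a Riccati equation over `A` has a solution algebraic over `A(s)`, where `s` is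
transcendental and `s ∣ s′` in `A[s]`, then it has a solution in `A`. -/
lemma IsRiccatiSolution.exists_of_transcendental {s : Ω} (hs : Transcendental A s) (q : A[X])
    (hq : s′ = aeval s (X * q)) {n : ℕ} {a : ℕ → A} {u : Ω} (hu : IsAlgebraic A⟮s⟯ u)
    (hsol : IsRiccatiSolution n (fun i => algebraMap A Ω (a i)) u) :
    ∃ c : A, IsRiccatiSolution n a c := by
  have hmem : ∀ r : A[X], aeval s r ∈ A⟮s⟯ := fun r =>
    (mem_adjoin_simple_iff A _).2 ⟨r, 1, by simp⟩
  have hstab : ∀ z ∈ A⟮s⟯, z′ ∈ A⟮s⟯ := fun z hz => deriv_mem_adjoin (by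
    rintro z rfl
    rw [hq]
    exact hmem _) hz
  let _ : Differential A⟮s⟯ := differentialOfStable _ hstab
  have _ : DifferentialAlgebra A⟮s⟯ Ω := differentialAlgebra_of_stable _ hstab
  have : CharZero A⟮s⟯ := charZero_of_injective_algebraMap (algebraMap A A⟮s⟯).injective
  let M := IntermediateField.adjoin A⟮s⟯ {u}
  have : FiniteDimensional A⟮s⟯ M := adjoin.finiteDimensional hu.isIntegral
  let _ : Algebra A[X] A⟮s⟯ := (aeval (AdjoinSimple.gen A s)).toAlgebra
  let _ : Algebra A[X] M := ((algebraMap A⟮s⟯ M).comp (algebraMap A[X] A⟮s⟯)).toAlgebra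
  have : IsScalarTower A[X] A⟮s⟯ M := .of_algebraMap_eq' rfl
  have hKval : ∀ r : A[X], algebraMap A⟮s⟯ Ω (algebraMap A[X] A⟮s⟯ r) = aeval s r := fun r => by
    change algebraMap A⟮s⟯ Ω (aeval (AdjoinSimple.gen A s) r) = _
    rw [← aeval_algebraMap_apply, AdjoinSimple.algebraMap_gen]
  have hMval : ∀ r : A[X], algebraMap M Ω (algebraMap A[X] M r) = aeval s r := hKval
  have : IsScalarTower A A[X] M := .of_algebraMap_eq fun x => by
    apply (algebraMap M Ω).injective
    rw [hMval, Polynomial.algebraMap_eq, aeval_C]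
    rfl
  have : FaithfulSMul A[X] A⟮s⟯ := by
    rw [faithfulSMul_iff_algebraMap_injective]
    refine (injective_iff_map_eq_zero _).2 fun r hr => ?_
    by_contra hne
    exact hs ⟨r, hne, by rw [← hKval, hr, map_zero]⟩
  have : IsFractionRing A[X] A⟮s⟯ := IsFractionRing.of_field A[X] A⟮s⟯ fun z => by
    obtain ⟨r, r', h⟩ := (mem_adjoin_simple_iff A (z : Ω)).1 z.2
    refine ⟨r, r', ?_⟩
    apply (algebraMap A⟮s⟯ Ω).injective
    rw [map_div₀, hKval, hKval]
    exact h
  have hder : ∀ z : M, algebraMap M Ω z′ = (algebraMap M Ω z)′ := fun z =>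
    (deriv_algebraMap z).symm
  have : DifferentialAlgebra A M := ⟨fun x => by
    apply (algebraMap M Ω).injective
    rw [hder]
    exact deriv_algebraMap (B := Ω) x⟩
  obtain ⟨v, hA, hres, hv⟩ := exists_differential_place A A⟮s⟯ M q (by
    apply (algebraMap M Ω).injective
    rw [hder, hMval, hMval, aeval_X, hq])
  refine IsRiccatiSolution.exists_residue v hA hres hv (u := AdjoinSimple.gen A⟮s⟯ u) ?_
  apply (algebraMap M Ω).injective
  rw [map_zero, ← hsol]
  simp only [map_add, map_sum, map_mul, map_riccati (algebraMap M Ω) hder]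
  rfl

/-- The same for the adjunction of an integral or of an exponential of integral. -/
lemma IsRiccatiSolution.exists_of_isAlgebraic_adjoin {t : Ω}
    (ht : (∃ b : A, t′ = algebraMap A Ω b) ∨ ∃ b : A, t′ = algebraMap A Ω b * t) {n : ℕ}
    {a : ℕ → A} {u : Ω} (hu : IsAlgebraic A⟮t⟯ u)
    (hsol : IsRiccatiSolution n (fun i => algebraMap A Ω (a i)) u) :
    ∃ c : A, IsRiccatiSolution n a c := by
  by_cases halg : IsAlgebraic A t
  · have : FiniteDimensional A A⟮t⟯ := adjoin.finiteDimensional halg.isIntegral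
    have hu' : IsAlgebraic A u := hu.restrictScalars A
    obtain ⟨c, rfl⟩ := mem_range_algebraMap_of_isAlgebraic hu'
    refine ⟨c, (algebraMap A Ω).injective ?_⟩
    rw [map_zero, ← hsol]
    simp [map_riccati (algebraMap A Ω) (fun z => (deriv_algebraMap z).symm)]
  · have ht0 : t ≠ 0 := by
      rintro rfl
      exact halg isAlgebraic_zero
    -- The place is taken at `t = ∞`: for an integral, `t` need not divide `t′`, whereas `s = 1 / t`
    -- always divides `s′`. Explicitly `s′ = s (-b s)` for an integral and `s′ = s (-b)` for an
    -- exponential of integral.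
    have heq : A⟮t⟯ = A⟮t⁻¹⟯ := by
      refine le_antisymm ?_ ?_ <;> rw [adjoin_simple_le_iff]
      · simpa using inv_mem (mem_adjoin_simple_self A t⁻¹)
      · exact inv_mem (mem_adjoin_simple_self A t)
    rw [heq] at hu
    have htr : Transcendental A t⁻¹ := fun h => halg (by simpa using h.inv)
    obtain ⟨b, hb⟩ | ⟨b, hb⟩ := ht
    · refine exists_of_transcendental htr (-(C b * X)) ?_ hu hsol
      rw [Derivation.leibniz_inv, hb]
      simp
      ring
    · refine exists_of_transcendental htr (-C b) ?_ hu hsol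
      rw [Derivation.leibniz_inv, hb]
      simp
      field_simp

end RiccatiStep

end FunctionalDiffField

/-! ### Calculus of meromorphic functions on Riemann surfaces -/

namespace RiemannSurface

open Filter Topology

variable {U V : RiemannSurface.{u}}

/-! ### Charts -/

lemma mem_codiscrete_iff {S : Set U} : S ∈ codiscrete U ↔ ∀ p, ∀ᶠ q in 𝓝[≠] p, q ∈ S := by
  rw [codiscrete, mem_codiscreteWithin_iff_forall_mem_nhdsNE]
  simp [Filter.Eventually]

lemma eventually_codiscrete_iff {P : U → Prop} :
    (∀ᶠ q in codiscrete U, P q) ↔ ∀ p, ∀ᶠ q in 𝓝[≠] p, P q :=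
  mem_codiscrete_iff

/-- A property that holds off a closed discrete set holds near every point where it holds. -/
lemma eventually_nhds_of_codiscrete {P : U → Prop} (h : ∀ᶠ q in codiscrete U, P q) :
    ∀ᶠ q in codiscrete U, ∀ᶠ r in 𝓝 q, P r := by
  filter_upwards [h] with q hq
  exact (mem_codiscrete'.1 h).1.mem_nhds hq

lemma tendsto_chart_nhdsNE (p : U) :
    Tendsto (chartAt ℂ p) (𝓝[≠] p) (𝓝[≠] (chartAt ℂ p p)) := by
  refine tendsto_nhdsWithin_iff.2 ⟨?_, ?_⟩
  · exact ((chartAt ℂ p).continuousAt (mem_chart_source ℂ p)).mono_left nhdsWithin_le_nhds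
  · filter_upwards [self_mem_nhdsWithin, nhdsWithin_le_nhds (chart_source_mem_nhds ℂ p)]
      with q hq hqs h
    exact hq ((chartAt ℂ p).injOn hqs (mem_chart_source ℂ p) h)

lemma tendsto_chart_symm_nhdsNE (p : U) :
    Tendsto (chartAt ℂ p).symm (𝓝[≠] (chartAt ℂ p p)) (𝓝[≠] p) := by
  have hp := mem_chart_source ℂ p
  have hp' := mem_chart_target ℂ p
  refine tendsto_nhdsWithin_iff.2 ⟨?_, ?_⟩
  · have := (chartAt ℂ p).symm.continuousAt (x := chartAt ℂ p p) hp'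
    rw [ContinuousAt, (chartAt ℂ p).left_inv hp] at this
    exact this.mono_left nhdsWithin_le_nhds
  · filter_upwards [self_mem_nhdsWithin, nhdsWithin_le_nhds (chart_target_mem_nhds ℂ p)]
      with z hz hzs h
    refine hz ?_
    rw [← (chartAt ℂ p).right_inv hzs, h]
    rfl

lemma eventually_nhdsNE_iff {P : U → Prop} {p : U} :
    (∀ᶠ q in 𝓝[≠] p, P q) ↔ ∀ᶠ z in 𝓝[≠] (chartAt ℂ p p), P ((chartAt ℂ p).symm z) := by
  refine ⟨fun h => (tendsto_chart_symm_nhdsNE p).eventually h, fun h => ?_⟩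
  filter_upwards [(tendsto_chart_nhdsNE p).eventually h,
    nhdsWithin_le_nhds (chart_source_mem_nhds ℂ p)] with q hq hqs
  rwa [(chartAt ℂ p).left_inv hqs] at hq

instance neBot_nhdsNE (p : U) : (𝓝[≠] p).NeBot :=
  (tendsto_chart_symm_nhdsNE p).neBot

/-- This makes the ring of function classes nontrivial, so that homomorphisms from fields into it
are injective, and it allows generic points to be chosen. -/
instance neBot_codiscrete : (codiscrete U).NeBot := by
  obtain ⟨p⟩ : Nonempty U := inferInstance
  refine ⟨fun h => ?_⟩
  have h1 : (∅ : Set U) ∈ codiscrete U := by simp [h]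
  have h2 := mem_codiscrete_iff.1 h1 p
  simp only [Set.mem_empty_iff_false, eventually_false_iff_eq_bot] at h2
  exact (neBot_nhdsNE p).ne h2

lemma eventually_chart_mem_source {p q : U} (hq : q ∈ (chartAt ℂ p).source) :
    ∀ᶠ z in 𝓝 (chartAt ℂ q q), (chartAt ℂ q).symm z ∈ (chartAt ℂ p).source := by
  have hc := (chartAt ℂ q).symm.continuousAt (x := chartAt ℂ q q) (mem_chart_target ℂ q)
  rw [ContinuousAt, (chartAt ℂ q).left_inv (mem_chart_source ℂ q)] at hc
  exact hc.eventually ((chartAt ℂ p).open_source.mem_nhds hq)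

lemma comp_chart_symm_eventuallyEq {X : Type*} (f : U → X) {p q : U}
    (hq : q ∈ (chartAt ℂ p).source) :
    f ∘ (chartAt ℂ q).symm =ᶠ[𝓝 (chartAt ℂ q q)]
      (f ∘ (chartAt ℂ p).symm) ∘ (chartAt ℂ p ∘ (chartAt ℂ q).symm) := by
  filter_upwards [eventually_chart_mem_source hq] with z hz
  simp [(chartAt ℂ p).left_inv hz]

lemma analyticAt_transition {p q r : U} (hp : r ∈ (chartAt ℂ p).source)
    (hq : r ∈ (chartAt ℂ q).source) :
    AnalyticAt ℂ (chartAt ℂ p ∘ (chartAt ℂ q).symm) (chartAt ℂ q r) := by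
  apply ContDiffAt.analyticAt
  rw [← contMDiffAt_iff_contDiffAt]
  refine ContMDiffAt.comp (I' := 𝓘(ℂ)) _ ?_ ?_
  · rw [(chartAt ℂ q).left_inv hq]
    exact (contMDiffOn_chart (n := ω)).contMDiffAt ((chartAt ℂ p).open_source.mem_nhds hp)
  · exact (contMDiffOn_chart_symm (n := ω)).contMDiffAt
      ((chartAt ℂ q).open_target.mem_nhds ((chartAt ℂ q).map_source hq))

/-- The two transition maps are mutually inverse near the point, so by the chain rule their
derivatives multiply to `1`. -/
lemma deriv_transition_ne_zero {p q : U} (hq : q ∈ (chartAt ℂ p).source) :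
    deriv (chartAt ℂ p ∘ (chartAt ℂ q).symm) (chartAt ℂ q q) ≠ 0 := by
  intro h0
  have h1 := (analyticAt_transition hq (mem_chart_source ℂ q)).differentiableAt
  have h2 := (analyticAt_transition (mem_chart_source ℂ q) hq).differentiableAt
  have hval : (chartAt ℂ p ∘ (chartAt ℂ q).symm) (chartAt ℂ q q) = chartAt ℂ p q := by
    simp
  have h3 : (chartAt ℂ q ∘ (chartAt ℂ p).symm) ∘ (chartAt ℂ p ∘ (chartAt ℂ q).symm)
      =ᶠ[𝓝 (chartAt ℂ q q)] id := by
    filter_upwards [eventually_chart_mem_source hq, chart_target_mem_nhds ℂ q] with z hz hz'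
    simp [(chartAt ℂ p).left_inv hz, (chartAt ℂ q).right_inv hz']
  have h4 := h3.deriv_eq
  rw [deriv_comp _ (by rwa [hval]) h1, h0, mul_zero, deriv_id'] at h4
  exact zero_ne_one h4

/-- `f` is holomorphic at `q`. -/
def HolomorphicAt (f : U → ℂ) (q : U) : Prop :=
  AnalyticAt ℂ (f ∘ (chartAt ℂ q).symm) (chartAt ℂ q q)

lemma HolomorphicAt.of_chart {f : U → ℂ} {p q : U} (hq : q ∈ (chartAt ℂ p).source)
    (h : AnalyticAt ℂ (f ∘ (chartAt ℂ p).symm) (chartAt ℂ p q)) : HolomorphicAt f q := by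
  refine AnalyticAt.congr ?_ (comp_chart_symm_eventuallyEq f hq).symm
  refine AnalyticAt.comp ?_ (analyticAt_transition hq (mem_chart_source ℂ q))
  simpa using h

lemma HolomorphicAt.chart {f : U → ℂ} {p q : U} (hq : q ∈ (chartAt ℂ p).source)
    (h : HolomorphicAt f q) : AnalyticAt ℂ (f ∘ (chartAt ℂ p).symm) (chartAt ℂ p q) := by
  have h1 : f ∘ (chartAt ℂ p).symm =ᶠ[𝓝 (chartAt ℂ p q)]
      (f ∘ (chartAt ℂ q).symm) ∘ (chartAt ℂ q ∘ (chartAt ℂ p).symm) := by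
    have hc := (chartAt ℂ p).symm.continuousAt (x := chartAt ℂ p q)
      ((chartAt ℂ p).map_source hq)
    rw [ContinuousAt, (chartAt ℂ p).left_inv hq] at hc
    filter_upwards [hc.eventually (chart_source_mem_nhds ℂ q)] with z hz
    simp [(chartAt ℂ q).left_inv hz]
  refine AnalyticAt.congr ?_ h1.symm
  refine AnalyticAt.comp ?_ (analyticAt_transition (mem_chart_source ℂ q) hq)
  rw [Function.comp_apply, (chartAt ℂ p).left_inv hq]
  exact h

lemma deriv_chart_mul {f : U → ℂ} {p q : U} (hq : q ∈ (chartAt ℂ p).source)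
    (h : HolomorphicAt f q) :
    deriv (f ∘ (chartAt ℂ q).symm) (chartAt ℂ q q) =
      deriv (f ∘ (chartAt ℂ p).symm) (chartAt ℂ p q) *
        deriv (chartAt ℂ p ∘ (chartAt ℂ q).symm) (chartAt ℂ q q) := by
  have h1 := (analyticAt_transition hq (mem_chart_source ℂ q)).differentiableAt
  rw [(comp_chart_symm_eventuallyEq f hq).deriv_eq, deriv_comp _ ?_ h1]
  · simp
  · simpa using (h.chart hq).differentiableAt

/-- `df / dx` may be computed in any chart. -/
lemma derivWrt_eq_chart {x f : U → ℂ} {p q : U} (hq : q ∈ (chartAt ℂ p).source)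
    (hx : HolomorphicAt x q) (hf : HolomorphicAt f q) :
    U.derivWrt x f q = deriv (f ∘ (chartAt ℂ p).symm) (chartAt ℂ p q) /
      deriv (x ∘ (chartAt ℂ p).symm) (chartAt ℂ p q) := by
  rw [derivWrt, deriv_chart_mul hq hx, deriv_chart_mul hq hf,
    mul_div_mul_right _ _ (deriv_transition_ne_zero hq)]

/-! ### Meromorphic functions -/

lemma IsMeromorphic.holomorphicAt {f : U → ℂ} (hf : U.IsMeromorphic f) :
    ∀ᶠ q in codiscrete U, HolomorphicAt f q := by
  rw [eventually_codiscrete_iff]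
  intro p
  filter_upwards [(tendsto_chart_nhdsNE p).eventually (hf p).eventually_analyticAt,
    nhdsWithin_le_nhds (chart_source_mem_nhds ℂ p)] with q hq hqs
  exact .of_chart hqs hq

/-- The identity theorem. -/
lemma IsMeromorphic.eventually_eq_zero {f : U → ℂ} (hf : U.IsMeromorphic f) {p : U}
    (hp : ∀ᶠ q in 𝓝[≠] p, f q = 0) : ∀ᶠ q in codiscrete U, f q = 0 := by
  rw [eventually_codiscrete_iff]
  -- Near each point a meromorphic function either vanishes identically or has no zeros off the
  -- point, so `S` is open and closed, and connectedness applies.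
  set S : Set U := {p | ∀ᶠ q in 𝓝[≠] p, f q = 0} with hS
  have hdich : ∀ p : U, (∀ᶠ q in 𝓝[≠] p, f q = 0) ∨ ∀ᶠ q in 𝓝[≠] p, f q ≠ 0 := fun p => by
    rw [eventually_nhdsNE_iff, eventually_nhdsNE_iff (P := fun q => f q ≠ 0)]
    exact (hf p).eventually_eq_zero_or_eventually_ne_zero
  have hnear : ∀ {P : U → Prop} {p : U}, (∀ᶠ q in 𝓝[≠] p, P q) →
      ∀ᶠ q in 𝓝 p, ∀ᶠ r in 𝓝[≠] q, P r := by
    intro P p h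
    have h1 : ∀ᶠ q in 𝓝[≠] p, ∀ᶠ r in 𝓝[≠] q, P r := by
      filter_upwards [eventually_eventually_nhdsWithin.2 h, self_mem_nhdsWithin] with q hq hqp
      rw [IsOpen.nhdsWithin_eq isOpen_compl_singleton hqp] at hq
      exact hq.filter_mono nhdsWithin_le_nhds
    rw [eventually_nhdsWithin_iff] at h1
    filter_upwards [h1] with q hq
    rcases eq_or_ne q p with rfl | hne
    · exact h
    · exact hq hne
  have hopen : IsOpen S := isOpen_iff_mem_nhds.2 fun p hp => hnear hp
  have hclosed : IsClosed S := by
    rw [← isOpen_compl_iff, isOpen_iff_mem_nhds]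
    intro p hp
    filter_upwards [hnear ((hdich p).resolve_left hp)] with q hq hqS
    obtain ⟨r, h1, h2⟩ := (hq.and hqS).exists
    exact h1 h2
  have huniv := IsClopen.eq_univ ⟨hclosed, hopen⟩ ⟨p, hp⟩
  exact fun p => (huniv ▸ Set.mem_univ p : p ∈ S)

lemma IsMeromorphic.const (c : ℂ) : U.IsMeromorphic fun _ => c := fun _ => .const _ _

lemma IsMeromorphic.add {f g : U → ℂ} (hf : U.IsMeromorphic f) (hg : U.IsMeromorphic g) :
    U.IsMeromorphic (f + g) := fun p => (hf p).add (hg p)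

lemma IsMeromorphic.mul {f g : U → ℂ} (hf : U.IsMeromorphic f) (hg : U.IsMeromorphic g) :
    U.IsMeromorphic (f * g) := fun p => (hf p).mul (hg p)

lemma IsMeromorphic.neg {f : U → ℂ} (hf : U.IsMeromorphic f) : U.IsMeromorphic (-f) :=
  fun p => (hf p).neg

lemma IsMeromorphic.inv {f : U → ℂ} (hf : U.IsMeromorphic f) : U.IsMeromorphic f⁻¹ :=
  fun p => (hf p).inv

lemma IsMeromorphic.eventually_ne_zero {f : U → ℂ} (hf : U.IsMeromorphic f)
    (hne : ¬∀ᶠ q in codiscrete U, f q = 0) : ∀ᶠ q in codiscrete U, f q ≠ 0 := by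
  rw [eventually_codiscrete_iff]
  intro p
  rw [eventually_nhdsNE_iff (P := fun q => f q ≠ 0)]
  refine (hf p).eventually_eq_zero_or_eventually_ne_zero.resolve_left fun h => hne ?_
  exact hf.eventually_eq_zero (eventually_nhdsNE_iff.2 h)

lemma IsMeromorphic.eventually_eq_const {f : U → ℂ} (hf : U.IsMeromorphic f) {p : U} {c : ℂ}
    (hp : ∀ᶠ q in 𝓝[≠] p, f q = c) : ∀ᶠ q in codiscrete U, f q = c := by
  have := (hf.add (IsMeromorphic.const (-c))).eventually_eq_zero (p := p) (by
    filter_upwards [hp] with q hq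
    simp [hq])
  filter_upwards [this] with q hq
  simpa [add_neg_eq_zero] using hq

/-- A meromorphic function whose differential vanishes near a point is constant. -/
lemma IsMeromorphic.eventually_eq_const_of_deriv {f : U → ℂ} (hf : U.IsMeromorphic f) {p : U}
    (hp : ∀ᶠ z in 𝓝[≠] (chartAt ℂ p p), deriv (f ∘ (chartAt ℂ p).symm) z = 0) :
    ∃ c, ∀ᶠ q in codiscrete U, f q = c := by
  have h1 : ∀ᶠ z in 𝓝[≠] (chartAt ℂ p p), ∀ᶠ w in 𝓝 z,
      deriv (f ∘ (chartAt ℂ p).symm) w = 0 := by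
    filter_upwards [eventually_eventually_nhdsWithin.2 hp, self_mem_nhdsWithin] with z hz hzp
    rwa [IsOpen.nhdsWithin_eq isOpen_compl_singleton hzp] at hz
  obtain ⟨z, hz, hz1, hzt⟩ := (h1.and ((hf p).eventually_analyticAt.and
    (nhdsWithin_le_nhds (chart_target_mem_nhds ℂ p)))).exists
  obtain ⟨ε, hε, hball⟩ := Metric.eventually_nhds_iff_ball.1 (hz.and hz1.eventually_analyticAt)
  set q := (chartAt ℂ p).symm z with hq
  have hqs : q ∈ (chartAt ℂ p).source := (chartAt ℂ p).map_target hzt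
  have hqz : chartAt ℂ p q = z := (chartAt ℂ p).right_inv hzt
  refine ⟨f q, hf.eventually_eq_const (p := q) (nhdsWithin_le_nhds ?_)⟩
  have hc := (chartAt ℂ p).continuousAt hqs
  rw [ContinuousAt, hqz] at hc
  filter_upwards [hc.eventually (Metric.ball_mem_nhds z hε),
    (chartAt ℂ p).open_source.mem_nhds hqs] with r hr hrs
  have := Metric.isOpen_ball.is_const_of_deriv_eq_zero
    (convex_ball z ε).isPreconnected
    (fun w hw => (hball w hw).2.differentiableAt.differentiableWithinAt)
    (fun w hw => (hball w hw).1) hr (Metric.mem_ball_self hε)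
  simpa [(chartAt ℂ p).left_inv hrs] using this

lemma IsMeromorphic.eventually_deriv_ne_zero {f : U → ℂ} (hf : U.IsMeromorphic f)
    (hne : ¬∃ c, ∀ᶠ q in codiscrete U, f q = c) (p : U) :
    ∀ᶠ z in 𝓝[≠] (chartAt ℂ p p), deriv (f ∘ (chartAt ℂ p).symm) z ≠ 0 :=
  (hf p).deriv.eventually_eq_zero_or_eventually_ne_zero.resolve_left fun h =>
    hne (hf.eventually_eq_const_of_deriv h)

lemma IsMeromorphic.derivWrt_eventuallyEq {x f : U → ℂ} (hx : U.IsMeromorphic x)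
    (hf : U.IsMeromorphic f) (p : U) :
    U.derivWrt x f ∘ (chartAt ℂ p).symm =ᶠ[𝓝[≠] (chartAt ℂ p p)]
      deriv (f ∘ (chartAt ℂ p).symm) / deriv (x ∘ (chartAt ℂ p).symm) := by
  filter_upwards [(hx p).eventually_analyticAt, (hf p).eventually_analyticAt,
    nhdsWithin_le_nhds (chart_target_mem_nhds ℂ p)] with z hxz hfz hzt
  have hzs := (chartAt ℂ p).map_target hzt
  have hz := (chartAt ℂ p).right_inv hzt
  rw [Function.comp_apply, derivWrt_eq_chart hzs (.of_chart hzs (by rwa [hz]))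
    (.of_chart hzs (by rwa [hz])), hz]
  rfl

lemma IsMeromorphic.derivWrt {x f : U → ℂ} (hx : U.IsMeromorphic x) (hf : U.IsMeromorphic f) :
    U.IsMeromorphic (U.derivWrt x f) := fun p =>
  ((hf p).deriv.div (hx p).deriv).congr (hx.derivWrt_eventuallyEq hf p).symm

/-- A meromorphic function with zero derivative is constant. -/
lemma IsMeromorphic.eventually_eq_const_of_derivWrt {x f : U → ℂ} (hx : U.IsMeromorphic x)
    (hne : ¬∃ c, ∀ᶠ q in codiscrete U, x q = c) (hf : U.IsMeromorphic f)
    (h : ∀ᶠ q in codiscrete U, U.derivWrt x f q = 0) :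
    ∃ c, ∀ᶠ q in codiscrete U, f q = c := by
  obtain ⟨p⟩ : Nonempty U := inferInstance
  refine hf.eventually_eq_const_of_deriv (p := p) ?_
  have h1 := eventually_nhdsNE_iff.1 (eventually_codiscrete_iff.1 h p)
  filter_upwards [h1, hx.derivWrt_eventuallyEq hf p, hx.eventually_deriv_ne_zero hne p]
    with z hz1 hz2 hz3
  rw [Function.comp_apply, hz1, Pi.div_apply, eq_comm, div_eq_zero_iff] at hz2
  exact hz2.resolve_right hz3

lemma derivWrt_congr {x y f g : U → ℂ} (hxy : ∀ᶠ q in codiscrete U, x q = y q)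
    (hfg : ∀ᶠ q in codiscrete U, f q = g q) :
    ∀ᶠ q in codiscrete U, U.derivWrt x f q = U.derivWrt y g q := by
  filter_upwards [eventually_nhds_of_codiscrete hxy, eventually_nhds_of_codiscrete hfg]
    with q hx hf
  have hc := (chartAt ℂ q).symm.continuousAt (x := chartAt ℂ q q) (mem_chart_target ℂ q)
  rw [ContinuousAt, (chartAt ℂ q).left_inv (mem_chart_source ℂ q)] at hc
  have h1 : x ∘ (chartAt ℂ q).symm =ᶠ[𝓝 (chartAt ℂ q q)] y ∘ (chartAt ℂ q).symm :=
    hc.eventually hx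
  have h2 : f ∘ (chartAt ℂ q).symm =ᶠ[𝓝 (chartAt ℂ q q)] g ∘ (chartAt ℂ q).symm :=
    hc.eventually hf
  rw [derivWrt, derivWrt, h1.deriv_eq, h2.deriv_eq]

lemma derivWrt_add {x f g : U → ℂ} {q : U} (hf : HolomorphicAt f q) (hg : HolomorphicAt g q) :
    U.derivWrt x (f + g) q = U.derivWrt x f q + U.derivWrt x g q := by
  rw [derivWrt, derivWrt, derivWrt, ← add_div, ← deriv_add hf.differentiableAt hg.differentiableAt]
  rfl

lemma derivWrt_mul {x f g : U → ℂ} {q : U} (hf : HolomorphicAt f q) (hg : HolomorphicAt g q) :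
    U.derivWrt x (f * g) q = f q * U.derivWrt x g q + g q * U.derivWrt x f q := by
  have h : HasDerivAt ((f * g) ∘ (chartAt ℂ q).symm) _ (chartAt ℂ q q) :=
    hf.differentiableAt.hasDerivAt.mul hg.differentiableAt.hasDerivAt
  simp only [derivWrt, h.deriv, Function.comp_apply,
    (chartAt ℂ q).left_inv (mem_chart_source ℂ q)]
  ring

lemma derivWrt_comp {x f : U → ℂ} {q : U} {φ : ℂ → ℂ} (hf : HolomorphicAt f q)
    (hφ : DifferentiableAt ℂ φ (f q)) :
    U.derivWrt x (φ ∘ f) q = deriv φ (f q) * U.derivWrt x f q := by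
  have hval : (f ∘ (chartAt ℂ q).symm) (chartAt ℂ q q) = f q := by simp
  rw [← hval] at hφ
  have h : HasDerivAt ((φ ∘ f) ∘ (chartAt ℂ q).symm) _ (chartAt ℂ q q) :=
    hφ.hasDerivAt.comp _ hf.differentiableAt.hasDerivAt
  rw [derivWrt, h.deriv, hval, derivWrt, mul_div_assoc]

/-! ### Analytic maps -/

section Map

variable {π : V → U}

lemma analyticAt_chart_comp (hπ : ContMDiff 𝓘(ℂ) 𝓘(ℂ) ω π) (v : V) :
    AnalyticAt ℂ (chartAt ℂ (π v) ∘ π ∘ (chartAt ℂ v).symm) (chartAt ℂ v v) := by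
  have h := (contMDiffAt_iff.1 (hπ v)).2
  simp only [ModelWithCorners.range_eq_univ, contDiffWithinAt_univ] at h
  exact h.analyticAt

lemma eventually_map_mem_chart_source (hπ : ContMDiff 𝓘(ℂ) 𝓘(ℂ) ω π) (v : V) :
    ∀ᶠ w in 𝓝 v, π w ∈ (chartAt ℂ (π v)).source :=
  hπ.continuous.continuousAt.eventually (chart_source_mem_nhds ℂ (π v))

/-- A nonconstant analytic map has nonzero differential near every point, possibly not at it. -/
lemma eventually_deriv_map_ne_zero (hπ : ContMDiff 𝓘(ℂ) 𝓘(ℂ) ω π)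
    (hne : ¬∃ p, ∀ v, π v = p) (v : V) :
    ∀ᶠ z in 𝓝[≠] (chartAt ℂ v v),
      deriv (chartAt ℂ (π v) ∘ π ∘ (chartAt ℂ v).symm) z ≠ 0 := by
  -- The points near which `π` is constant form an open and closed set. If it is nonempty, `π` is
  -- constant; off it, the derivative in charts has isolated zeros.
  set S : Set V := {v | ∀ᶠ w in 𝓝 v, π w = π v} with hS
  have hder : ∀ v ∉ S, ∀ᶠ z in 𝓝[≠] (chartAt ℂ v v),
      deriv (chartAt ℂ (π v) ∘ π ∘ (chartAt ℂ v).symm) z ≠ 0 := by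
    intro v hv
    refine (analyticAt_chart_comp hπ v).deriv.eventually_eq_zero_or_eventually_ne_zero.resolve_left
      fun h => hv ?_
    obtain ⟨ε, hε, hball⟩ := Metric.eventually_nhds_iff_ball.1
      (h.and (analyticAt_chart_comp hπ v).eventually_analyticAt)
    have hc := (chartAt ℂ v).continuousAt (mem_chart_source ℂ v)
    filter_upwards [hc.eventually (Metric.ball_mem_nhds _ hε), chart_source_mem_nhds ℂ v,
      eventually_map_mem_chart_source hπ v] with w hw hws hwπ
    have := Metric.isOpen_ball.is_const_of_deriv_eq_zero
      (convex_ball _ ε).isPreconnected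
      (fun w hw => (hball w hw).2.differentiableAt.differentiableWithinAt)
      (fun w hw => (hball w hw).1) hw (Metric.mem_ball_self hε)
    simp only [Function.comp_apply, (chartAt ℂ v).left_inv hws,
      (chartAt ℂ v).left_inv (mem_chart_source ℂ v)] at this
    exact (chartAt ℂ (π v)).injOn hwπ (mem_chart_source ℂ _) this
  have hopen : IsOpen S := isOpen_iff_mem_nhds.2 fun v hv => by
    filter_upwards [eventually_eventually_nhds.2 hv, hv] with w hw hwv
    filter_upwards [hw] with r hr
    rw [hr, hwv]
  have hclosed : IsClosed S := by
    rw [← isOpen_compl_iff, isOpen_iff_mem_nhds]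
    intro v hv
    have h1 := (tendsto_chart_nhdsNE v).eventually (hder v hv)
    rw [eventually_nhdsWithin_iff] at h1
    filter_upwards [h1, chart_source_mem_nhds ℂ v] with w hw hws hwS
    have hwv : w ≠ v := by
      rintro rfl
      exact hv hwS
    refine hw hwv ?_
    have hc := (chartAt ℂ v).symm.continuousAt (x := chartAt ℂ v w)
      ((chartAt ℂ v).map_source hws)
    rw [ContinuousAt, (chartAt ℂ v).left_inv hws] at hc
    have : chartAt ℂ (π v) ∘ π ∘ (chartAt ℂ v).symm =ᶠ[𝓝 (chartAt ℂ v w)]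
        fun _ => chartAt ℂ (π v) (π w) := by
      filter_upwards [hc.eventually hwS] with z hz
      simp [hz]
    rw [this.deriv_eq, deriv_const]
  by_cases hv : v ∈ S
  · have huniv := IsClopen.eq_univ ⟨hclosed, hopen⟩ ⟨v, hv⟩
    refine absurd ⟨π v, fun w => ?_⟩ hne
    have hloc : IsLocallyConstant π := (IsLocallyConstant.iff_eventually_eq π).2 fun w =>
      (huniv ▸ Set.mem_univ w : w ∈ S)
    exact hloc.apply_eq_of_preconnectedSpace w v
  · exact hder v hv

/-- Preimages of closed discrete sets under nonconstant analytic maps are closed discrete. -/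
lemma tendsto_codiscrete (hπ : ContMDiff 𝓘(ℂ) 𝓘(ℂ) ω π) (hne : ¬∃ p, ∀ v, π v = p) :
    Tendsto π (codiscrete V) (codiscrete U) := by
  intro S hS
  rw [mem_map, mem_codiscrete_iff]
  intro v
  have hS' := mem_codiscrete_iff.1 hS (π v)
  refine Tendsto.eventually (f := π) (l₂ := 𝓝[≠] (π v)) ?_ hS'
  refine tendsto_nhdsWithin_iff.2
    ⟨hπ.continuous.continuousAt.mono_left nhdsWithin_le_nhds, ?_⟩
  set g := chartAt ℂ (π v) ∘ π ∘ (chartAt ℂ v).symm with hg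
  have hga := analyticAt_chart_comp hπ v
  have h1 := (hga.sub (analyticAt_const (v := chartAt ℂ (π v) (π v)))
    ).eventually_eq_zero_or_eventually_ne_zero.resolve_left fun h => by
    have h2 : g =ᶠ[𝓝 (chartAt ℂ v v)] fun _ => chartAt ℂ (π v) (π v) := by
      filter_upwards [h] with z hz
      exact sub_eq_zero.1 hz
    have h3 := h2.deriv
    obtain ⟨z, hz, hz'⟩ := ((eventually_deriv_map_ne_zero hπ hne v).and
      (nhdsWithin_le_nhds h3)).exists
    exact hz (by rw [hz', deriv_const])
  filter_upwards [(tendsto_chart_nhdsNE v).eventually h1,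
    nhdsWithin_le_nhds (chart_source_mem_nhds ℂ v)] with w hw hws hwv
  refine hw ?_
  have hwv' : π w = π v := hwv
  simp [(chartAt ℂ v).left_inv hws, hwv']

/-- `d(π^* f) / d(π^* x) = π^* (df / dx)`. -/
lemma derivWrt_comp_map (hπ : ContMDiff 𝓘(ℂ) 𝓘(ℂ) ω π) (hne : ¬∃ p, ∀ v, π v = p)
    {x f : U → ℂ} (hx : U.IsMeromorphic x) (hf : U.IsMeromorphic f) :
    ∀ᶠ v in codiscrete V, V.derivWrt (x ∘ π) (f ∘ π) v = U.derivWrt x f (π v) := by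
  have hxf := (tendsto_codiscrete hπ hne).eventually (hx.holomorphicAt.and hf.holomorphicAt)
  rw [eventually_codiscrete_iff] at hxf ⊢
  intro v
  have hga := analyticAt_chart_comp hπ v
  filter_upwards [hxf v, (tendsto_chart_nhdsNE v).eventually (eventually_deriv_map_ne_zero hπ hne v),
    nhdsWithin_le_nhds (chart_source_mem_nhds ℂ v),
    nhdsWithin_le_nhds (eventually_map_mem_chart_source hπ v).eventually_nhds,
    (tendsto_chart_nhdsNE v).eventually (nhdsWithin_le_nhds hga.eventually_analyticAt)]
    with w hw hder hws hwπ hwg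
  set g := chartAt ℂ (π v) ∘ π ∘ (chartAt ℂ v).symm with hg
  have hwπ' := hwπ.self_of_nhds
  have hc := (chartAt ℂ v).symm.continuousAt (x := chartAt ℂ v w) ((chartAt ℂ v).map_source hws)
  rw [ContinuousAt, (chartAt ℂ v).left_inv hws] at hc
  have hgw : g (chartAt ℂ v w) = chartAt ℂ (π v) (π w) := by
    simp [hg, (chartAt ℂ v).left_inv hws]
  -- The chain rule gives `f` and `x` the same factor `g′`, nonzero near the point, which cancels in
  -- the quotient.
  have key : ∀ h : U → ℂ, HolomorphicAt h (π w) → HolomorphicAt (h ∘ π) w ∧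
      deriv ((h ∘ π) ∘ (chartAt ℂ v).symm) (chartAt ℂ v w) =
        deriv (h ∘ (chartAt ℂ (π v)).symm) (chartAt ℂ (π v) (π w)) * deriv g (chartAt ℂ v w) := by
    intro h hh
    have hh' := hh.chart hwπ'
    have heq : (h ∘ π) ∘ (chartAt ℂ v).symm =ᶠ[𝓝 (chartAt ℂ v w)]
        (h ∘ (chartAt ℂ (π v)).symm) ∘ g := by
      filter_upwards [hc.eventually hwπ] with z hz
      simp [hg, (chartAt ℂ (π v)).left_inv hz]
    rw [← hgw] at hh'
    refine ⟨.of_chart hws ((hh'.comp hwg).congr heq.symm), ?_⟩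
    rw [heq.deriv_eq, deriv_comp _ hh'.differentiableAt hwg.differentiableAt, hgw]
  obtain ⟨hx1, hx2⟩ := key x hw.1
  obtain ⟨hf1, hf2⟩ := key f hw.2
  rw [derivWrt_eq_chart hws hx1 hf1, hx2, hf2, mul_div_mul_right _ _ hder,
    derivWrt_eq_chart hwπ' hw.1 hw.2]

end Map

end RiemannSurface

namespace RiemannSurface

open Filter Topology

variable {U V : RiemannSurface.{u}}

lemma HolomorphicAt.meromorphicAt {f : U → ℂ} {p : U} (h : HolomorphicAt f p) :
    MeromorphicAt (f ∘ (chartAt ℂ p).symm) (chartAt ℂ p p) := AnalyticAt.meromorphicAt h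

lemma not_forall_eq (U : RiemannSurface.{u}) : ¬∃ p : U, ∀ q : U, q = p := by
  rintro ⟨p, hp⟩
  obtain ⟨q, hq⟩ := (neBot_nhdsNE p).nonempty_of_mem self_mem_nhdsWithin
  exact hq (hp q)

lemma IsMeromorphic.comp_map {π : V → U} (hπ : ContMDiff 𝓘(ℂ) 𝓘(ℂ) ω π) {f : U → ℂ}
    (hf : U.IsMeromorphic f) : V.IsMeromorphic (f ∘ π) := by
  intro v
  have hga := analyticAt_chart_comp hπ v
  have hc := (chartAt ℂ v).symm.continuousAt (x := chartAt ℂ v v) (mem_chart_target ℂ v)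
  rw [ContinuousAt, (chartAt ℂ v).left_inv (mem_chart_source ℂ v)] at hc
  have heq : (f ∘ π) ∘ (chartAt ℂ v).symm =ᶠ[𝓝 (chartAt ℂ v v)]
      (f ∘ (chartAt ℂ (π v)).symm) ∘ (chartAt ℂ (π v) ∘ π ∘ (chartAt ℂ v).symm) := by
    filter_upwards [hc.eventually (eventually_map_mem_chart_source hπ v)] with z hz
    simp [(chartAt ℂ (π v)).left_inv hz]
  refine MeromorphicAt.congr ?_ (heq.symm.filter_mono nhdsWithin_le_nhds)
  refine MeromorphicAt.comp_analyticAt ?_ hga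
  simpa using hf (π v)

/-- `x` is not the class of a constant. -/
def IsNonconstant (x : U → ℂ) : Prop := ¬∃ c, ∀ᶠ q in codiscrete U, x q = c

lemma isNonconstant_iff {x : U → ℂ} :
    IsNonconstant x ↔ ¬∃ c : ℂ, (x : U.FunctionClass) = ((fun _ => c : U → ℂ)) := by
  simp only [IsNonconstant, Germ.coe_eq]
  rfl

lemma derivWrt_const (x : U → ℂ) (c : ℂ) (q : U) : U.derivWrt x (fun _ => c) q = 0 := by
  have : (fun _ => c : U → ℂ) ∘ (chartAt ℂ q).symm = fun _ => c := rfl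
  rw [derivWrt, this, deriv_const, zero_div]

lemma derivWrt_self {x : U → ℂ} (hx : U.IsMeromorphic x) (hne : IsNonconstant x) :
    ∀ᶠ q in codiscrete U, U.derivWrt x x q = 1 := by
  rw [eventually_codiscrete_iff]
  intro p
  rw [eventually_nhdsNE_iff]
  filter_upwards [hx.derivWrt_eventuallyEq hx p, hx.eventually_deriv_ne_zero hne p] with z h1 h2
  rw [Function.comp_apply] at h1
  rw [h1, Pi.div_apply, div_self h2]

/-- The derivative of `π^* x` with respect to itself is the pullback of `dx / dx = 1`, whereas it
would be `0` for a constant. -/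
lemma IsNonconstant.comp_map {π : V → U} (hπ : ContMDiff 𝓘(ℂ) 𝓘(ℂ) ω π)
    (hne : ¬∃ p, ∀ v, π v = p) {x : U → ℂ} (hx : U.IsMeromorphic x) (h : IsNonconstant x) :
    IsNonconstant (x ∘ π) := by
  rintro ⟨c, hc⟩
  obtain ⟨v, h1, h2, h3⟩ := (((tendsto_codiscrete hπ hne).eventually (derivWrt_self hx h)).and
    ((derivWrt_comp_map hπ hne hx hx).and (derivWrt_congr hc hc))).exists
  rw [derivWrt_const, h2, h1] at h3
  exact one_ne_zero h3

/-! ### Open subsurfaces -/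

/-- A connected open subset of a Riemann surface. -/
noncomputable def restrict (U : RiemannSurface.{u}) (W : TopologicalSpace.Opens U)
    (hW : IsConnected (W : Set U)) : RiemannSurface.{u} where
  carrier := W
  connected := isConnected_iff_connectedSpace.1 hW

variable {W : TopologicalSpace.Opens U} {hW : IsConnected (W : Set U)}

/-- The inclusion of an open subsurface. -/
def inclusion (W : TopologicalSpace.Opens U) (hW : IsConnected (W : Set U)) :
    U.restrict W hW → U := Subtype.val

lemma contMDiff_inclusion : ContMDiff 𝓘(ℂ) 𝓘(ℂ) ω (inclusion W hW) := contMDiff_subtype_val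

lemma inclusion_mem (w : U.restrict W hW) : inclusion W hW w ∈ W := w.2

lemma inclusion_nonconstant : ¬∃ p, ∀ w, inclusion W hW w = p := by
  rintro ⟨p, hp⟩
  obtain ⟨w⟩ : Nonempty (U.restrict W hW) := inferInstance
  exact (U.restrict W hW).not_forall_eq ⟨w, fun w' => Subtype.ext ((hp w').trans (hp w).symm)⟩

lemma comp_inclusion_eventuallyEq (f : U → ℂ) (w : U.restrict W hW) :
    (f ∘ inclusion W hW) ∘ (chartAt ℂ w).symm =ᶠ[𝓝 (chartAt ℂ w w)]
      f ∘ (chartAt ℂ (inclusion W hW w)).symm := by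
  filter_upwards [chart_target_mem_nhds ℂ w] with z hz
  exact congrArg f (OpenPartialHomeomorph.subtypeRestr_symm_eqOn (chartAt ℂ (inclusion W hW w))
    ⟨w⟩ hz).symm

lemma derivWrt_comp_inclusion (x f : U → ℂ) (w : U.restrict W hW) :
    (U.restrict W hW).derivWrt (x ∘ inclusion W hW) (f ∘ inclusion W hW) w =
      U.derivWrt x f (inclusion W hW w) := by
  rw [derivWrt, derivWrt, (comp_inclusion_eventuallyEq x w).deriv_eq,
    (comp_inclusion_eventuallyEq f w).deriv_eq]
  rfl

lemma IsMeromorphic.of_holomorphicAt {f : U → ℂ} (h : ∀ q ∈ W, HolomorphicAt f q) :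
    (U.restrict W hW).IsMeromorphic (f ∘ inclusion W hW) := fun w =>
  ((h _ (inclusion_mem w)).meromorphicAt).congr
    ((comp_inclusion_eventuallyEq f w).symm.filter_mono nhdsWithin_le_nhds)

lemma exists_isConnected_subset {p : U} {N : Set U} (hN : N ∈ 𝓝 p) :
    ∃ W : TopologicalSpace.Opens U, IsConnected (W : Set U) ∧ (W : Set U) ⊆ N := by
  have : LocallyConnectedSpace U := ChartedSpace.locallyConnectedSpace ℂ U
  obtain ⟨S, ⟨hS1, hS2, hS3⟩, hS4⟩ :=
    (LocallyConnectedSpace.open_connected_basis p).mem_iff.1 hN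
  exact ⟨⟨S, hS1⟩, hS3, hS4⟩

lemma HolomorphicAt.eventually {f : U → ℂ} {p : U} (h : HolomorphicAt f p) :
    ∀ᶠ q in 𝓝 p, HolomorphicAt f q := by
  have hc := (chartAt ℂ p).continuousAt (mem_chart_source ℂ p)
  filter_upwards [hc.eventually (AnalyticAt.eventually_analyticAt h), chart_source_mem_nhds ℂ p]
    with q hq hqs
  exact .of_chart hqs hq

lemma HolomorphicAt.continuousAt {f : U → ℂ} {p : U} (h : HolomorphicAt f p) :
    ContinuousAt f p := by
  have hc := (chartAt ℂ p).continuousAt (mem_chart_source ℂ p)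
  have h1 : ContinuousAt ((f ∘ (chartAt ℂ p).symm) ∘ chartAt ℂ p) p :=
    ContinuousAt.comp (AnalyticAt.continuousAt h) hc
  refine h1.congr ?_
  filter_upwards [chart_source_mem_nhds ℂ p] with q hq
  simp [(chartAt ℂ p).left_inv hq]

/-- A nonzero meromorphic function has a logarithm on an open subsurface. -/
lemma IsMeromorphic.exists_log {f : U → ℂ} (hf : U.IsMeromorphic f)
    (hne : ¬∀ᶠ q in codiscrete U, f q = 0) :
    ∃ (W : TopologicalSpace.Opens U) (z : U → ℂ), IsConnected (W : Set U) ∧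
      ∀ q ∈ W, HolomorphicAt z q ∧ Complex.exp (z q) = f q := by
  obtain ⟨p, hp, hp0⟩ := (hf.holomorphicAt.and (hf.eventually_ne_zero hne)).exists
  -- Normalizing by `f p` brings the values near `1`, where the principal logarithm is analytic.
  have hslit : ∀ᶠ q in 𝓝 p, f q / f p ∈ Complex.slitPlane := by
    refine (hp.continuousAt.div_const (f p)).eventually (Complex.isOpen_slitPlane.mem_nhds ?_)
    simp only [div_self hp0]
    exact Complex.one_mem_slitPlane
  obtain ⟨W, hW, hsub⟩ := exists_isConnected_subset (hslit.and hp.eventually)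
  refine ⟨W, fun q => Complex.log (f q / f p) + Complex.log (f p), hW, fun q hq => ⟨?_, ?_⟩⟩
  · obtain ⟨h1, h2⟩ := hsub hq
    refine AnalyticAt.add (AnalyticAt.clog (AnalyticAt.div_const h2) ?_) analyticAt_const
    simpa using h1
  · have h1 := Complex.slitPlane_ne_zero (hsub hq).1
    rw [Complex.exp_add, Complex.exp_log h1, Complex.exp_log hp0, div_mul_cancel₀ _ hp0]

/-- Finitely many meromorphic functions have integrals on an open subsurface. -/
lemma IsMeromorphic.exists_integral {x : U → ℂ} (hx : U.IsMeromorphic x) (hne : IsNonconstant x)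
    {ι : Type*} [Finite ι] {f : ι → U → ℂ} (hf : ∀ i, U.IsMeromorphic (f i)) :
    ∃ (W : TopologicalSpace.Opens U) (F : ι → U → ℂ), IsConnected (W : Set U) ∧
      ∀ i, ∀ q ∈ W, HolomorphicAt (F i) q ∧ U.derivWrt x (F i) q = f i q := by
  have hself := derivWrt_self hx hne
  obtain ⟨p, hp, hp0, hpf⟩ := (hx.holomorphicAt.and ((eventually_nhds_of_codiscrete hself).and
    (eventually_all.2 fun i => (hf i).holomorphicAt))).exists
  have hev : ∀ᶠ z in 𝓝 (chartAt ℂ p p), AnalyticAt ℂ (x ∘ (chartAt ℂ p).symm) z ∧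
      ∀ i, AnalyticAt ℂ (f i ∘ (chartAt ℂ p).symm) z :=
    (AnalyticAt.eventually_analyticAt hp).and
      (eventually_all.2 fun i => AnalyticAt.eventually_analyticAt (hpf i))
  obtain ⟨ε, hε, hball⟩ := Metric.eventually_nhds_iff_ball.1 hev
  -- In the coordinate, an integral with respect to `x` is a primitive of `f dx`. Finiteness of the
  -- index set provides one disc on which all integrands are holomorphic.
  have hprim : ∀ i, ∃ G : ℂ → ℂ, ∀ z ∈ Metric.ball (chartAt ℂ p p) ε,
      HasDerivAt G ((f i ∘ (chartAt ℂ p).symm) z * deriv (x ∘ (chartAt ℂ p).symm) z) z := by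
    intro i
    have hd : DifferentiableOn ℂ (fun z => (f i ∘ (chartAt ℂ p).symm) z *
        deriv (x ∘ (chartAt ℂ p).symm) z) (Metric.ball (chartAt ℂ p p) ε) := fun z hz =>
      (((hball z hz).2 i).differentiableAt.mul
        (hball z hz).1.deriv.differentiableAt).differentiableWithinAt
    obtain ⟨G, hG⟩ := hd.isExactOn_ball
    exact ⟨G, hG⟩
  choose G hG using hprim
  have hc := (chartAt ℂ p).continuousAt (mem_chart_source ℂ p)
  obtain ⟨W, hW, hsub⟩ := exists_isConnected_subset ((hp0.and hp.eventually).and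
    ((hc.eventually (Metric.ball_mem_nhds _ hε)).and (chart_source_mem_nhds ℂ p)))
  refine ⟨W, fun i => G i ∘ chartAt ℂ p, hW, fun i q hq => ?_⟩
  obtain ⟨⟨hq1, hq2⟩, hq3, hq4⟩ := hsub hq
  have heq : (G i ∘ chartAt ℂ p) ∘ (chartAt ℂ p).symm =ᶠ[𝓝 (chartAt ℂ p q)] G i := by
    filter_upwards [(chartAt ℂ p).open_target.mem_nhds ((chartAt ℂ p).map_source hq4)] with z hz
    simp [(chartAt ℂ p).right_inv hz]
  have hGa : AnalyticAt ℂ (G i) (chartAt ℂ p q) := by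
    refine DifferentiableOn.analyticAt (s := Metric.ball (chartAt ℂ p p) ε) (fun z hz =>
      (hG i z hz).differentiableAt.differentiableWithinAt) (Metric.isOpen_ball.mem_nhds hq3)
  have hhol : HolomorphicAt (G i ∘ chartAt ℂ p) q := .of_chart hq4 (hGa.congr heq.symm)
  refine ⟨hhol, ?_⟩
  rw [derivWrt_eq_chart hq4 hq2 hq2] at hq1
  have hx0 : deriv (x ∘ (chartAt ℂ p).symm) (chartAt ℂ p q) ≠ 0 := fun h => by simp [h] at hq1
  rw [derivWrt_eq_chart hq4 hq2 hhol, heq.deriv_eq, (hG i _ hq3).deriv,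
    mul_div_cancel_right₀ _ hx0, Function.comp_apply, (chartAt ℂ p).left_inv hq4]

end RiemannSurface

/-! ### Functional differential fields and their extensions -/

namespace FunctionalDiffField

open RiemannSurface Filter

variable (K : FunctionalDiffField.{u})

lemma toFun_injective : Function.Injective K.toFun :=
  haveI : Nontrivial K.surface.FunctionClass := inferInstance
  K.toFun.injective

lemma isNonconstant_x : IsNonconstant K.x := isNonconstant_iff.2 K.x_nonconstant

lemma deriv_algebraMap_complex (c : ℂ) : (algebraMap ℂ K c)′ = 0 := by
  apply K.toFun_injective
  rw [K.toFun_deriv _ _ (K.toFun_const c), map_zero]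
  exact congrArg _ (funext fun q => derivWrt_const K.x c q)

/-- The constants of a functional differential field are the complex numbers. -/
lemma mem_range_algebraMap_of_deriv_eq_zero (k : K) (h : k′ = 0) :
    k ∈ Set.range (algebraMap ℂ K) := by
  obtain ⟨f, hf, hk⟩ := K.meromorphic k
  have h1 := K.toFun_deriv k f hk
  rw [h, map_zero] at h1
  have h2 : ∀ᶠ q in codiscrete K.surface, K.surface.derivWrt K.x f q = 0 := by
    filter_upwards [Germ.coe_eq.1 h1] with q hq
    exact hq.symm
  obtain ⟨c, hc⟩ := K.x_meromorphic.eventually_eq_const_of_derivWrt K.isNonconstant_x hf h2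
  refine ⟨c, K.toFun_injective ?_⟩
  rw [K.toFun_const, hk]
  refine Germ.coe_eq.2 ?_
  filter_upwards [hc] with q hq
  exact hq.symm

instance instCharZero : CharZero K := charZero_of_injective_algebraMap (algebraMap ℂ K).injective

/-! ### The field of all meromorphic functions -/

section MeromorphicField

variable (U : RiemannSurface.{u})

/-- The ring of meromorphic functions on a Riemann surface. -/
def meromorphicSubring : Subring U.FunctionClass where
  carrier := {k | ∃ f : U → ℂ, U.IsMeromorphic f ∧ k = f}
  mul_mem' := by
    rintro _ _ ⟨f, hf, rfl⟩ ⟨g, hg, rfl⟩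
    exact ⟨f * g, hf.mul hg, rfl⟩
  one_mem' := ⟨1, .const 1, rfl⟩
  add_mem' := by
    rintro _ _ ⟨f, hf, rfl⟩ ⟨g, hg, rfl⟩
    exact ⟨f + g, hf.add hg, rfl⟩
  zero_mem' := ⟨0, .const 0, rfl⟩
  neg_mem' := by
    rintro _ ⟨f, hf, rfl⟩
    exact ⟨-f, hf.neg, rfl⟩

/-- By the identity theorem a nonzero meromorphic function vanishes only on a closed discrete set,
so the pointwise inverse is an inverse of classes. -/
noncomputable instance instFieldMeromorphic : Field (meromorphicSubring U) where
  inv k := ⟨(k : U.FunctionClass)⁻¹, by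
    obtain ⟨f, hf, hk⟩ := k.2
    exact ⟨f⁻¹, hf.inv, by rw [hk]; rfl⟩⟩
  exists_pair_ne := ⟨0, 1, zero_ne_one⟩
  mul_inv_cancel k hk := by
    obtain ⟨k, f, hf, rfl⟩ := k
    apply Subtype.ext
    refine Germ.coe_eq.2 ?_
    filter_upwards [hf.eventually_ne_zero fun h => hk (Subtype.ext (Germ.coe_eq.2 h))] with q hq
    exact mul_inv_cancel₀ hq
  inv_zero := by
    apply Subtype.ext
    exact congrArg (fun f : U → ℂ => (f : U.FunctionClass)) (funext fun _ => inv_zero)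
  nnqsmul := _
  nnqsmul_def _ _ := rfl
  qsmul := _
  qsmul_def _ _ := rfl

variable {U} in
/-- A meromorphic function that represents an element of the field. -/
noncomputable def meromorphicRep (k : meromorphicSubring U) : U → ℂ := k.2.choose

variable {U} in
lemma isMeromorphic_rep (k : meromorphicSubring U) : U.IsMeromorphic (meromorphicRep k) :=
  k.2.choose_spec.1

variable {U} in
lemma coe_rep (k : meromorphicSubring U) : (meromorphicRep k : U.FunctionClass) = k :=
  k.2.choose_spec.2.symm

variable {U} {x : U → ℂ} (hx : U.IsMeromorphic x)

/-- The derivative `df / dx` of a class of meromorphic functions. -/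
noncomputable def meromorphicDeriv (k : meromorphicSubring U) : meromorphicSubring U :=
  ⟨(U.derivWrt x (meromorphicRep k) : U → ℂ), _, hx.derivWrt (isMeromorphic_rep k), rfl⟩

lemma meromorphicDeriv_eq {k : meromorphicSubring U} {f : U → ℂ}
    (h : (k : U.FunctionClass) = f) :
    (meromorphicDeriv hx k : U.FunctionClass) = (U.derivWrt x f : U → ℂ) := by
  refine Germ.coe_eq.2 (derivWrt_congr (.of_forall fun _ => rfl) ?_)
  exact Germ.coe_eq.1 ((coe_rep k).trans h)

/-- The derivation `d / dx` on meromorphic functions. -/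
@[reducible]
noncomputable def differentialMeromorphic : Differential (meromorphicSubring U) where
  deriv := Derivation.mk'
    (AddMonoidHom.toIntLinearMap (AddMonoidHom.mk' (meromorphicDeriv hx) fun k l => by
      apply Subtype.ext
      have h : ((k + l : meromorphicSubring U) : U.FunctionClass) =
          ((meromorphicRep k + meromorphicRep l : U → ℂ)) := by
        rw [Subring.coe_add, ← coe_rep k, ← coe_rep l]
        rfl
      rw [meromorphicDeriv_eq hx h]
      refine Germ.coe_eq.2 ?_
      filter_upwards [(isMeromorphic_rep k).holomorphicAt, (isMeromorphic_rep l).holomorphicAt]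
        with q hk hl
      exact derivWrt_add hk hl))
    (fun k l => by
      apply Subtype.ext
      have h : ((k * l : meromorphicSubring U) : U.FunctionClass) =
          ((meromorphicRep k * meromorphicRep l : U → ℂ)) := by
        rw [Subring.coe_mul, ← coe_rep k, ← coe_rep l]
        rfl
      refine (meromorphicDeriv_eq hx h).trans ?_
      simp only [smul_eq_mul, Subring.coe_add, Subring.coe_mul, ← coe_rep k, ← coe_rep l]
      refine Germ.coe_eq.2 ?_
      filter_upwards [(isMeromorphic_rep k).holomorphicAt, (isMeromorphic_rep l).holomorphicAt]
        with q hk hl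
      exact derivWrt_mul hk hl)

/-- The functional differential field of all meromorphic functions on a Riemann surface. -/
noncomputable def meromorphicField (hx : U.IsMeromorphic x) (hne : IsNonconstant x) :
    FunctionalDiffField.{u} where
  surface := U
  x := x
  x_meromorphic := hx
  x_nonconstant := isNonconstant_iff.1 hne
  carrier := meromorphicSubring U
  differential := differentialMeromorphic hx
  algebra := RingHom.toAlgebra
    (((Germ.coeRingHom (codiscrete U)).comp (algebraMap ℂ (U → ℂ))).codRestrict
      (meromorphicSubring U) fun c => ⟨fun _ => c, .const c, rfl⟩)
  toFun := (meromorphicSubring U).subtype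
  meromorphic k := k.2
  toFun_const _ := rfl
  toFun_deriv _ _ h := meromorphicDeriv_eq hx h

end MeromorphicField

namespace Extension

variable {K} (L : Extension K)

lemma toFun_algebraMap (k : K) (f : K.surface → ℂ) (h : K.toFun k = f) :
    L.top.toFun (algebraMap K L.top k) = (f ∘ L.proj : L.top.surface → ℂ) :=
  L.toFun_pullback k f h

/-- An extension is not required to respect derivations; this follows from the chain rule, because
the coordinate on the upper surface is the pullback of `x`. -/
instance instDifferentialAlgebra : DifferentialAlgebra K L.top where
  deriv_algebraMap k := by
    apply L.top.toFun_injective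
    obtain ⟨f, hf, hk⟩ := K.meromorphic k
    rw [L.top.toFun_deriv _ _ (L.toFun_algebraMap k f hk),
      L.toFun_algebraMap _ _ (K.toFun_deriv k f hk)]
    refine Germ.coe_eq.2 ?_
    filter_upwards [derivWrt_congr (f := f ∘ L.proj) (Germ.coe_eq.1 L.x_eq)
      (.of_forall fun _ => rfl),
      derivWrt_comp_map L.proj_analytic L.proj_nonconstant K.x_meromorphic hf] with v h1 h2
    rw [h1, h2]
    rfl

instance instIsScalarTower : IsScalarTower ℂ K L.top := .of_algebraMap_eq fun c => by
  apply L.top.toFun_injective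
  rw [L.toFun_algebraMap _ _ (K.toFun_const c), L.top.toFun_const]
  rfl

/-- The composition of extensions. -/
noncomputable def trans (M : Extension L.top) : Extension K where
  top := M.top
  proj := L.proj ∘ M.proj
  proj_analytic := L.proj_analytic.comp M.proj_analytic
  proj_nonconstant := by
    -- Were the composite constant, the pulled back `x` would be constant.
    rintro ⟨p, hp⟩
    have h := (tendsto_codiscrete M.proj_analytic M.proj_nonconstant).eventually
      (Germ.coe_eq.1 L.x_eq)
    refine M.top.isNonconstant_x ⟨K.x p, ?_⟩
    filter_upwards [Germ.coe_eq.1 M.x_eq, h] with v h1 h2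
    rw [h1, Function.comp_apply, h2]
    exact congrArg K.x (hp v)
  x_eq := by
    rw [M.x_eq]
    exact Germ.coe_eq.2 ((tendsto_codiscrete M.proj_analytic M.proj_nonconstant).eventually
      (Germ.coe_eq.1 L.x_eq))
  pullback := M.pullback.comp L.pullback
  toFun_pullback k f h := M.toFun_pullback _ _ (L.toFun_pullback k f h)

/-- The field of all meromorphic functions on a surface over the given one. -/
noncomputable def ofMap (K : FunctionalDiffField.{u}) {V : RiemannSurface.{u}} {π : V → K.surface}
    (hπ : ContMDiff 𝓘(ℂ) 𝓘(ℂ) ω π) (hne : ¬∃ p, ∀ v, π v = p) : Extension K where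
  top := meromorphicField (K.x_meromorphic.comp_map hπ)
    (K.isNonconstant_x.comp_map hπ hne K.x_meromorphic)
  proj := π
  proj_analytic := hπ
  proj_nonconstant := hne
  x_eq := rfl
  pullback :=
    { toFun := fun k => ⟨(K.toFun k).compTendsto π (tendsto_codiscrete hπ hne), by
        obtain ⟨f, hf, hk⟩ := K.meromorphic k
        exact ⟨f ∘ π, hf.comp_map hπ, by rw [hk]; rfl⟩⟩
      map_one' := by
        apply Subtype.ext
        simp only [map_one]
        rfl
      map_mul' := fun k l => by
        apply Subtype.ext
        obtain ⟨f, hf, hk⟩ := K.meromorphic k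
        obtain ⟨g, hg, hl⟩ := K.meromorphic l
        simp only [map_mul, hk, hl]
        rfl
      map_zero' := by
        apply Subtype.ext
        simp only [map_zero]
        rfl
      map_add' := fun k l => by
        apply Subtype.ext
        obtain ⟨f, hf, hk⟩ := K.meromorphic k
        obtain ⟨g, hg, hl⟩ := K.meromorphic l
        simp only [map_add, hk, hl]
        rfl }
  toFun_pullback k f h := by
    change (K.toFun k).compTendsto π (tendsto_codiscrete hπ hne) = _
    rw [h]
    rfl

/-- A differential subfield of an extension, as an extension. -/
noncomputable def sub (E : IntermediateField K L.top) (hE : ∀ z ∈ E, z′ ∈ E) : Extension K where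
  top :=
    { surface := L.top.surface
      x := L.top.x
      x_meromorphic := L.top.x_meromorphic
      x_nonconstant := L.top.x_nonconstant
      carrier := E
      differential := differentialOfStable E hE
      algebra := ((algebraMap K E).comp (algebraMap ℂ K)).toAlgebra
      toFun := L.top.toFun.comp (algebraMap E L.top)
      meromorphic := fun k => L.top.meromorphic k
      toFun_const := fun c => by
        change L.top.toFun (algebraMap K L.top (algebraMap ℂ K c)) = _
        rw [← IsScalarTower.algebraMap_apply ℂ K L.top]
        exact L.top.toFun_const c
      toFun_deriv := fun k f h => L.top.toFun_deriv k f h }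
  proj := L.proj
  proj_analytic := L.proj_analytic
  proj_nonconstant := L.proj_nonconstant
  x_eq := L.x_eq
  pullback := algebraMap K E
  toFun_pullback k f h := L.toFun_pullback k f h

/-- An extension as an extension of a differential subfield. -/
noncomputable def overSub (E : IntermediateField K L.top) (hE : ∀ z ∈ E, z′ ∈ E) :
    Extension (L.sub E hE).top where
  top := L.top
  proj := id
  proj_analytic := contMDiff_id
  proj_nonconstant := L.top.surface.not_forall_eq
  x_eq := rfl
  pullback := algebraMap E L.top
  toFun_pullback _ _ h := h

end Extension

end FunctionalDiffField

/-! ### Towers of quadratures -/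

namespace FunctionalDiffField

lemma isAlgebraic_map {R S A B : Type*} [Field R] [Field S] [Field A] [Field B] [Algebra R A]
    [Algebra S B] (ψ : R →+* S) (φ : A →+* B)
    (h : ∀ r, algebraMap S B (ψ r) = φ (algebraMap R A r)) {y : A} (hy : IsAlgebraic R y) :
    IsAlgebraic S (φ y) := by
  obtain ⟨p, hp, hpy⟩ := hy
  refine ⟨p.map ψ, (Polynomial.map_ne_zero_iff ψ.injective).2 hp, ?_⟩
  have h' : (algebraMap S B).comp ψ = φ.comp (algebraMap R A) := RingHom.ext h
  rw [Polynomial.aeval_def, Polynomial.eval₂_map, h', ← Polynomial.hom_eval₂,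
    ← Polynomial.aeval_def, hpy, map_zero]

namespace Extension

variable {K : FunctionalDiffField.{u}} (L : Extension K)

lemma mem_diffAdjoin {M : Set L.top} {z : L.top} : z ∈ L.diffAdjoin M ↔
    ∀ E : IntermediateField K L.top, (∀ z ∈ E, z′ ∈ E) → M ⊆ E → z ∈ E := by
  rw [diffAdjoin, ← SetLike.mem_coe, IntermediateField.coe_sInf]
  simp

lemma subset_diffAdjoin (M : Set L.top) : M ⊆ L.diffAdjoin M := fun _ hz =>
  L.mem_diffAdjoin.2 fun _ _ h => h hz

lemma diffAdjoin_le {M : Set L.top} {E : IntermediateField K L.top} (hE : ∀ z ∈ E, z′ ∈ E)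
    (hM : M ⊆ E) : L.diffAdjoin M ≤ E := fun _ hz => L.mem_diffAdjoin.1 hz E hE hM

lemma deriv_mem_diffAdjoin (M : Set L.top) : ∀ z ∈ L.diffAdjoin M, z′ ∈ L.diffAdjoin M :=
  fun z hz => L.mem_diffAdjoin.2 fun E hE hM => hE z (L.mem_diffAdjoin.1 hz E hE hM)

lemma deriv_mem_bot : ∀ z ∈ (⊥ : IntermediateField K L.top),
    z′ ∈ (⊥ : IntermediateField K L.top) := by
  intro z hz
  obtain ⟨k, rfl⟩ := IntermediateField.mem_bot.1 hz
  rw [deriv_algebraMap]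
  exact IntermediateField.algebraMap_mem _ _

/-! ### Representability by generalized quadratures -/

variable {L}

lemma QuadratureTower.deriv_mem {E : IntermediateField K L.top} (h : L.QuadratureTower E) :
    ∀ z ∈ E, z′ ∈ E := by
  cases h with
  | base => exact L.deriv_mem_bot
  | algebraic | integral | expIntegral => exact L.deriv_mem_diffAdjoin _

lemma isAlgebraic_of_le {E F : IntermediateField K L.top} (h : E ≤ F) {y : L.top}
    (hy : IsAlgebraic E y) : IsAlgebraic F y :=
  isAlgebraic_map (IntermediateField.inclusion h).toRingHom (RingHom.id _) (fun _ => rfl) hy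

lemma diffAdjoin_insert_le {E F : IntermediateField K L.top} {y : L.top} (hEF : E ≤ F)
    (hF : ∀ z ∈ F, z′ ∈ F) (hy : y ∈ F) : L.diffAdjoin (insert y (E : Set L.top)) ≤ F :=
  L.diffAdjoin_le hF (Set.insert_subset hy hEF)

lemma le_diffAdjoin_insert (E : IntermediateField K L.top) (y : L.top) :
    E ≤ L.diffAdjoin (insert y (E : Set L.top)) :=
  (Set.subset_insert y _).trans (L.subset_diffAdjoin _)

lemma mem_diffAdjoin_insert (E : IntermediateField K L.top) (y : L.top) :
    y ∈ L.diffAdjoin (insert y (E : Set L.top)) :=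
  L.subset_diffAdjoin _ (Set.mem_insert _ _)

/-- Two towers are contained in a third one. -/
lemma QuadratureTower.exists_le {E F : IntermediateField K L.top} (hE : L.QuadratureTower E)
    (hF : L.QuadratureTower F) : ∃ G, L.QuadratureTower G ∧ E ≤ G ∧ F ≤ G := by
  have key : ∀ {F G : IntermediateField K L.top} (y : L.top), E ≤ G → F ≤ G →
      L.QuadratureTower (L.diffAdjoin (insert y (G : Set L.top))) →
      ∃ G', L.QuadratureTower G' ∧ E ≤ G' ∧ L.diffAdjoin (insert y (F : Set L.top)) ≤ G' :=
    fun {F G} y hEG hFG h => ⟨_, h, hEG.trans (le_diffAdjoin_insert G y),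
      diffAdjoin_insert_le (hFG.trans (le_diffAdjoin_insert G y)) h.deriv_mem
        (mem_diffAdjoin_insert G y)⟩
  -- Each step of the second tower is repeated over the field reached so far, which starts from `E`.
  induction hF with
  | base => exact ⟨E, hE, le_rfl, bot_le⟩
  | algebraic F y _ hy ih =>
    obtain ⟨G, hG, hEG, hFG⟩ := ih
    exact key y hEG hFG (.algebraic G y hG (isAlgebraic_of_le hFG hy))
  | integral F y _ hy ih =>
    obtain ⟨G, hG, hEG, hFG⟩ := ih
    exact key y hEG hFG (.integral G y hG (hFG hy))
  | expIntegral F y a _ ha hy ih =>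
    obtain ⟨G, hG, hEG, hFG⟩ := ih
    exact key y hEG hFG (.expIntegral G y a hG (hFG ha) hy)

lemma exists_tower_of_finite (S : Finset L.top) (hS : ∀ y ∈ S, L.IsRepresentable y) :
    ∃ E, L.QuadratureTower E ∧ (S : Set L.top) ⊆ E := by
  classical
  induction S using Finset.induction_on with
  | empty => exact ⟨⊥, .base, by simp⟩
  | insert y S _ ih =>
    obtain ⟨E, hE, hSE⟩ := ih fun z hz => hS z (Finset.mem_insert_of_mem hz)
    obtain ⟨F, hF, hyF⟩ := hS y (Finset.mem_insert_self y S)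
    obtain ⟨G, hG, hEG, hFG⟩ := hE.exists_le hF
    refine ⟨G, hG, ?_⟩
    rw [Finset.coe_insert]
    exact Set.insert_subset (hFG hyF) (hSE.trans hEG)

variable (L) in
/-- The field of elements representable by generalized quadratures. -/
def representableField : IntermediateField K L.top where
  carrier := {y | L.IsRepresentable y}
  mul_mem' := by
    rintro y z ⟨E, hE, hy⟩ ⟨F, hF, hz⟩
    obtain ⟨G, hG, hEG, hFG⟩ := hE.exists_le hF
    exact ⟨G, hG, mul_mem (hEG hy) (hFG hz)⟩
  add_mem' := by
    rintro y z ⟨E, hE, hy⟩ ⟨F, hF, hz⟩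
    obtain ⟨G, hG, hEG, hFG⟩ := hE.exists_le hF
    exact ⟨G, hG, add_mem (hEG hy) (hFG hz)⟩
  algebraMap_mem' k := ⟨⊥, .base, IntermediateField.algebraMap_mem _ k⟩
  inv_mem' := by
    rintro y ⟨E, hE, hy⟩
    exact ⟨E, hE, inv_mem hy⟩

lemma deriv_mem_representableField {y : L.top} (h : y ∈ L.representableField) :
    y′ ∈ L.representableField := by
  obtain ⟨E, hE, hy⟩ := h
  exact ⟨E, hE, hE.deriv_mem y hy⟩

/-- An annihilating polynomial has finitely many coefficients, so they lie in one tower, over which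
`y` is algebraic. -/
lemma mem_representableField_of_isAlgebraic {y : L.top}
    (h : IsAlgebraic L.representableField y) : y ∈ L.representableField := by
  classical
  obtain ⟨p, hp, hpy⟩ := h
  set P := p.map (algebraMap L.representableField L.top) with hP
  have hP0 : P ≠ 0 := (Polynomial.map_ne_zero_iff (RingHom.injective _)).2 hp
  obtain ⟨E, hE, hsub⟩ := exists_tower_of_finite (P.support.image P.coeff) (by
    intro z hz
    obtain ⟨k, _, rfl⟩ := Finset.mem_image.1 hz
    rw [hP, Polynomial.coeff_map]
    exact (p.coeff k).2)
  have hlift : P ∈ Polynomial.lifts (algebraMap E L.top) := by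
    refine (Polynomial.lifts_iff_coeff_lifts P).2 fun k => ?_
    by_cases hk : k ∈ P.support
    · exact ⟨⟨_, hsub (Finset.mem_coe.2 (Finset.mem_image_of_mem _ hk))⟩, rfl⟩
    · rw [Polynomial.notMem_support_iff.1 hk]
      exact ⟨0, map_zero _⟩
  obtain ⟨q, hq⟩ := (Polynomial.mem_lifts P).1 hlift
  refine ⟨_, .algebraic E y hE ⟨q, ?_, ?_⟩, mem_diffAdjoin_insert E y⟩
  · rintro rfl
    exact hP0 (by rw [← hq, Polynomial.map_zero])
  · rw [Polynomial.aeval_def, ← Polynomial.eval_map, hq, hP, Polynomial.eval_map,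
      ← Polynomial.aeval_def, hpy]

lemma mem_representableField_of_deriv_mem {y : L.top} (h : y′ ∈ L.representableField) :
    y ∈ L.representableField := by
  obtain ⟨E, hE, hy⟩ := h
  exact ⟨_, .integral E y hE hy, mem_diffAdjoin_insert E y⟩

lemma mem_representableField_of_deriv_eq {y a : L.top} (ha : a ∈ L.representableField)
    (h : y′ = a * y) : y ∈ L.representableField := by
  obtain ⟨E, hE, ha⟩ := ha
  exact ⟨_, .expIntegral E y a hE ha h, mem_diffAdjoin_insert E y⟩

/-- Representability is preserved by differential homomorphisms that map the base field to
representable elements. -/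
lemma IsRepresentable.map {K' : FunctionalDiffField.{u}} {L' : Extension K'}
    (φ : L.top →+* L'.top) (hφ : ∀ z, φ z′ = (φ z)′)
    (hK : ∀ k : K, L'.IsRepresentable (φ (algebraMap K L.top k))) {y : L.top}
    (hy : L.IsRepresentable y) : L'.IsRepresentable (φ y) := by
  -- The preimage of the field of representable elements is a differential field closed under all
  -- three kinds of adjunction, hence contains every tower.
  let S : IntermediateField K L.top :=
    (L'.representableField.toSubfield.comap φ).toIntermediateField hK
  have hSmem : ∀ {z}, z ∈ S ↔ φ z ∈ L'.representableField := Iff.rfl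
  have hS : ∀ z ∈ S, z′ ∈ S := fun z hz => by
    rw [hSmem, hφ]
    exact deriv_mem_representableField hz
  have hle : ∀ E, L.QuadratureTower E → E ≤ S := by
    intro E hE
    induction hE with
    | base => exact bot_le
    | algebraic E y _ hy ih =>
      refine diffAdjoin_insert_le ih hS (mem_representableField_of_isAlgebraic ?_)
      exact isAlgebraic_map ((φ.comp (algebraMap E L.top)).codRestrict
        L'.representableField.toSubfield fun z => ih z.2) φ (fun _ => rfl) hy
    | integral E y _ hy ih =>
      refine diffAdjoin_insert_le ih hS (mem_representableField_of_deriv_mem ?_)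
      rw [← hφ]
      exact ih hy
    | expIntegral E y a _ ha hy ih =>
      refine diffAdjoin_insert_le ih hS (mem_representableField_of_deriv_eq (ih ha) ?_)
      rw [← hφ, hy, map_mul]
  obtain ⟨E, hE, hyE⟩ := hy
  exact hle E hE hyE

/-! ### Algebraic solutions of the Riccati equation -/

open IntermediateField in
/-- If a Riccati equation over `K` has a solution algebraic over a tower of generalized
quadratures, it has a solution algebraic over `K`. -/
lemma QuadratureTower.exists_isAlgebraic_riccati {Ω : Type u} [Field Ω] [IsAlgClosed Ω]
    [Differential Ω] [Algebra L.top Ω] [DifferentialAlgebra L.top Ω] [Algebra K Ω]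
    [IsScalarTower K L.top Ω] {n : ℕ} {a : ℕ → K} {E : IntermediateField K L.top}
    (hE : L.QuadratureTower E) {u : Ω} (hu : IsAlgebraic E u)
    (hsol : IsRiccatiSolution n (fun i => algebraMap K Ω (a i)) u) :
    ∃ c : Ω, IsAlgebraic K c ∧ IsRiccatiSolution n (fun i => algebraMap K Ω (a i)) c := by
  have key : ∀ (E : IntermediateField K L.top) (y : L.top), L.QuadratureTower E →
      (∀ u : Ω, IsAlgebraic E u → IsRiccatiSolution n (fun i => algebraMap K Ω (a i)) u →
        ∃ c : Ω, IsAlgebraic K c ∧ IsRiccatiSolution n (fun i => algebraMap K Ω (a i)) c) →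
      (IsAlgebraic E y ∨ y′ ∈ E ∨ ∃ b ∈ E, y′ = b * y) →
      ∀ u : Ω, IsAlgebraic (L.diffAdjoin (insert y (E : Set L.top))) u →
        IsRiccatiSolution n (fun i => algebraMap K Ω (a i)) u →
        ∃ c : Ω, IsAlgebraic K c ∧ IsRiccatiSolution n (fun i => algebraMap K Ω (a i)) c := by
    intro E y hE ih hy u hu hsol
    let _ : Differential E := differentialOfStable E hE.deriv_mem
    have _ : DifferentialAlgebra E L.top := differentialAlgebra_of_stable E hE.deriv_mem
    have hEΩ : ∀ z : E, algebraMap E Ω z = algebraMap L.top Ω z := fun _ => rfl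
    have _ : DifferentialAlgebra E Ω := ⟨fun z => by
      rw [hEΩ, deriv_algebraMap]
      rfl⟩
    have : CharZero E := charZero_of_injective_algebraMap (algebraMap K E).injective
    -- Enlarging `E` to its algebraic closure in `Ω` supplies the algebraically closed coefficient
    -- field needed for residues, and a solution found in it is again algebraic over `E`, as the
    -- induction requires.
    let A := algebraicClosure E Ω
    have hA : ∀ z ∈ A, z′ ∈ A := fun z hz =>
      mem_algebraicClosure_iff.2 (isAlgebraic_deriv (mem_algebraicClosure_iff.1 hz))
    have hEA : ∀ z ∈ E, algebraMap L.top Ω z ∈ A := fun z hz =>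
      A.algebraMap_mem (⟨z, hz⟩ : E)
    let _ : Differential A := differentialOfStable A hA
    have _ : DifferentialAlgebra A Ω := differentialAlgebra_of_stable A hA
    have : CharZero A := charZero_of_injective_algebraMap (algebraMap E A).injective
    have : IsAlgClosed A := (algebraicClosure.isAlgClosure E Ω).isAlgClosed
    set t := algebraMap L.top Ω y with ht
    have htA : (∃ b : A, t′ = algebraMap A Ω b) ∨ ∃ b : A, t′ = algebraMap A Ω b * t := by
      rw [ht, deriv_algebraMap]
      obtain h | h | ⟨b, hb, h⟩ := hy
      -- An algebraic element lies in `A` together with its derivative, so it counts as an integral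
      -- over `A`.
      · have h1 : IsAlgebraic E t := isAlgebraic_map (RingHom.id E) (algebraMap L.top Ω)
          (fun _ => rfl) h
        refine Or.inl ⟨⟨t′, hA t (mem_algebraicClosure_iff.2 h1)⟩, ?_⟩
        rw [← deriv_algebraMap]
        rfl
      · exact Or.inl ⟨⟨_, hEA _ h⟩, rfl⟩
      · refine Or.inr ⟨⟨_, hEA b hb⟩, ?_⟩
        rw [h, map_mul]
        rfl
    have hstab : ∀ z ∈ A⟮t⟯, z′ ∈ A⟮t⟯ := fun z hz => deriv_mem_adjoin (by
      rintro z rfl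
      obtain ⟨b, hb⟩ | ⟨b, hb⟩ := htA
      · rw [hb]
        exact A⟮t⟯.algebraMap_mem b
      · rw [hb]
        exact mul_mem (A⟮t⟯.algebraMap_mem b) (mem_adjoin_simple_self A _)) hz
    have hAt : ∀ z ∈ A, z ∈ A⟮t⟯ := fun z hz => A⟮t⟯.algebraMap_mem (⟨z, hz⟩ : A)
    let S : IntermediateField K L.top :=
      (A⟮t⟯.toSubfield.comap (algebraMap L.top Ω)).toIntermediateField fun k =>
        hAt _ (hEA _ (E.algebraMap_mem k))
    have hle : L.diffAdjoin (insert y (E : Set L.top)) ≤ S := by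
      refine diffAdjoin_insert_le (fun z hz => hAt _ (hEA z hz)) (fun z hz => ?_)
        (mem_adjoin_simple_self A t)
      change algebraMap L.top Ω z′ ∈ A⟮t⟯
      rw [← deriv_algebraMap]
      exact hstab _ hz
    have hu' : IsAlgebraic A⟮t⟯ u := isAlgebraic_map
      (((algebraMap L.top Ω).comp (algebraMap (L.diffAdjoin (insert y (E : Set L.top))) L.top)
        ).codRestrict A⟮t⟯.toSubfield fun z => hle z.2) (RingHom.id Ω) (fun _ => rfl) hu
    have hcoef : ∀ i, algebraMap A Ω (algebraMap E A (algebraMap K E (a i))) =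
        algebraMap K Ω (a i) := fun i => (IsScalarTower.algebraMap_apply K L.top Ω (a i)).symm
    obtain ⟨c, hc⟩ := IsRiccatiSolution.exists_of_isAlgebraic_adjoin
      (a := fun i => algebraMap E A (algebraMap K E (a i))) htA hu' (by
        simp only [hcoef]
        exact hsol)
    have hc' := hc.map (algebraMap A Ω) fun z => (deriv_algebraMap z).symm
    simp only [hcoef] at hc'
    exact ih _ (mem_algebraicClosure_iff.1 c.2) hc'
  induction hE generalizing u with
  | base =>
    refine ⟨u, isAlgebraic_map (botEquiv K L.top).toRingEquiv.toRingHom (RingHom.id Ω)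
      (fun r => ?_) hu, hsol⟩
    obtain ⟨k, rfl⟩ := (botEquiv K L.top).symm.surjective r
    change algebraMap K Ω (botEquiv K L.top ((botEquiv K L.top).symm k)) =
      algebraMap L.top Ω (algebraMap K L.top k)
    rw [AlgEquiv.apply_symm_apply, ← IsScalarTower.algebraMap_apply K L.top Ω]
  | algebraic E y hE hy ih => exact key E y hE (fun u => ih) (.inl hy) u hu hsol
  | integral E y hE hy ih => exact key E y hE (fun u => ih) (.inr (.inl hy)) u hu hsol
  | expIntegral E y b hE hb hy ih =>
    exact key E y hE (fun u => ih) (.inr (.inr ⟨b, hb, hy⟩)) u hu hsol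

end Extension

end FunctionalDiffField

/-! ### Solutions with algebraic logarithmic derivative -/

namespace FunctionalDiffField

open RiemannSurface Filter

/-- Reduction of order lowers the dimension of the solution space by one. -/
lemma exists_linearIndependent_reduced {C F : Type*} [Field C] [Field F] [Differential F]
    [Algebra C F] (hC : ∀ c : C, (algebraMap C F c)′ = 0)
    (hC' : ∀ z : F, z′ = 0 → z ∈ Set.range (algebraMap C F)) {n : ℕ} {v : Fin n → F}
    (hind : LinearIndependent C v) {y₁ : F} (hy : y₁ ≠ 0) :
    ∃ w : Fin (n - 1) → F, LinearIndependent C w ∧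
      ∀ j, ∃ y ∈ Submodule.span C (Set.range v), w j = (y / y₁)′ := by
  let T : F →ₗ[C] F :=
    { toFun := fun y => Differential.deriv (y / y₁)
      map_add' := fun y z => by rw [add_div, map_add]
      map_smul' := fun c y => by
        simp only [Algebra.smul_def, mul_div_assoc, Derivation.leibniz, hC, mul_zero,
          add_zero, RingHom.id_apply, Algebra.algebraMap_self] }
  set V := Submodule.span C (Set.range v) with hV
  have hVfin : FiniteDimensional C V := FiniteDimensional.span_of_finite C (Set.finite_range v)
  have hVrank : Module.finrank C V = n := by
    rw [finrank_span_eq_card hind, Fintype.card_fin]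
  -- If `(y / y₁)′ = 0`, then `y` is a constant multiple of `y₁`.
  have hker : Module.finrank C (LinearMap.ker (T.domRestrict V)) ≤ 1 := by
    let g : LinearMap.ker (T.domRestrict V) →ₗ[C] Submodule.span C {y₁} :=
      { toFun := fun y => ⟨(y : V), by
          have h : ((y : V) / y₁ : F)′ = 0 := y.2
          obtain ⟨c, hc⟩ := hC' _ h
          refine Submodule.mem_span_singleton.2 ⟨c, ?_⟩
          rw [Algebra.smul_def, hc, div_mul_cancel₀ _ hy]⟩
        map_add' := fun _ _ => rfl
        map_smul' := fun _ _ => rfl }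
    have hg : Function.Injective g := fun y z h =>
      Subtype.ext (Subtype.ext (congrArg (fun s : Submodule.span C {y₁} => (s : F)) h))
    refine (LinearMap.finrank_le_finrank_of_injective hg).trans ?_
    exact (finrank_span_singleton hy).le
  have hrange : n - 1 ≤ Module.finrank C (LinearMap.range (T.domRestrict V)) := by
    have := LinearMap.finrank_range_add_finrank_ker (T.domRestrict V)
    omega
  obtain ⟨w, hw⟩ := exists_linearIndependent_of_le_finrank hrange
  refine ⟨fun j => w j, hw.map' (Submodule.subtype _) (Submodule.ker_subtype _), fun j => ?_⟩
  obtain ⟨y, hy⟩ := (w j).2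
  exact ⟨y, y.2, hy.symm⟩

lemma isAlgebraic_of_map {R A B : Type*} [Field R] [Field A] [Field B] [Algebra R A]
    [Algebra R B] (φ : A →+* B) (h : ∀ r, φ (algebraMap R A r) = algebraMap R B r) {y : A}
    (hy : IsAlgebraic R (φ y)) : IsAlgebraic R y := by
  obtain ⟨p, hp, hpy⟩ := hy
  refine ⟨p, hp, φ.injective ?_⟩
  have h' : φ.comp (algebraMap R A) = algebraMap R B := RingHom.ext h
  rw [map_zero, ← hpy, Polynomial.aeval_def, Polynomial.aeval_def, Polynomial.hom_eval₂, h']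

namespace Extension

variable {K : FunctionalDiffField.{u}}

/-- Finitely many elements of `K` have integrals in some extension. -/
lemma exists_integral {ι : Type*} [Finite ι] (w : ι → K) :
    ∃ (R : Extension K) (I : ι → R.top), ∀ i, (I i)′ = algebraMap K R.top (w i) := by
  choose f hf hw using fun i => K.meromorphic (w i)
  obtain ⟨W, F, hW, hF⟩ := K.x_meromorphic.exists_integral K.isNonconstant_x hf
  let R := ofMap K (contMDiff_inclusion (hW := hW)) inclusion_nonconstant
  have hmem : ∀ i, ((F i ∘ inclusion W hW : K.surface.restrict W hW → ℂ) :
      (K.surface.restrict W hW).FunctionClass) ∈ meromorphicSubring (K.surface.restrict W hW) :=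
    fun i => ⟨_, .of_holomorphicAt fun q hq => (hF i q hq).1, rfl⟩
  let I : ι → R.top := fun i => (⟨_, hmem i⟩ : meromorphicSubring (K.surface.restrict W hW))
  refine ⟨R, I, fun i => R.top.toFun_injective ?_⟩
  refine (R.top.toFun_deriv (I i) (F i ∘ inclusion W hW) rfl).trans
    (Eq.trans ?_ (R.toFun_algebraMap _ _ (hw i)).symm)
  refine congrArg _ (funext fun v => ?_)
  exact (derivWrt_comp_inclusion K.x (F i) v).trans (hF i _ (inclusion_mem v)).2

/-- A nonzero element of `K` has a logarithm on the surface of some extension. -/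
lemma exists_log {y : K} (hy : y ≠ 0) :
    ∃ (R : Extension K) (z : R.top.surface → ℂ), R.top.surface.IsMeromorphic z ∧
      R.top.toFun (algebraMap K R.top y) =
        (fun p => Complex.exp (z p) : R.top.surface → ℂ) := by
  obtain ⟨f, hf, hyf⟩ := K.meromorphic y
  obtain ⟨W, z, hW, hz⟩ := hf.exists_log fun h => hy (K.toFun_injective (by
    rw [hyf, map_zero]
    exact Germ.coe_eq.2 h))
  let R := ofMap K (contMDiff_inclusion (hW := hW)) inclusion_nonconstant
  refine ⟨R, z ∘ inclusion W hW, .of_holomorphicAt fun q hq => (hz q hq).1, ?_⟩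
  rw [R.toFun_algebraMap _ _ hyf]
  exact congrArg _ (funext fun v => (hz _ (inclusion_mem v)).2.symm)

end Extension

variable {K : FunctionalDiffField.{u}}

/-- `(exp z)′ = z′ exp z`. -/
lemma coe_derivWrt_exp {z : K.surface → ℂ} (hz : K.surface.IsMeromorphic z) {y : K}
    (hy : K.toFun y = (fun p => Complex.exp (z p) : K.surface → ℂ)) :
    K.toFun y′ = ((K.surface.derivWrt K.x z : K.surface → ℂ) : K.surface.FunctionClass) *
      K.toFun y := by
  rw [K.toFun_deriv y _ hy, hy]
  refine Germ.coe_eq.2 ?_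
  filter_upwards [hz.holomorphicAt] with q hq
  have := derivWrt_comp (x := K.x) (φ := Complex.exp) hq Complex.differentiableAt_exp
  rw [Complex.deriv_exp, mul_comm] at this
  exact this

lemma ne_zero_of_toFun_eq_exp {z : K.surface → ℂ} {y : K}
    (hy : K.toFun y = (fun p => Complex.exp (z p) : K.surface → ℂ)) : y ≠ 0 := by
  rintro rfl
  rw [map_zero] at hy
  obtain ⟨q, hq⟩ := (Germ.coe_eq.1 hy : ∀ᶠ q in codiscrete K.surface, _).exists
  exact Complex.exp_ne_zero _ hq.symm

namespace Extension

variable {L : Extension K}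

lemma IsExpOfAlgebraicIntegral.ne_zero {y : L.top} (h : L.IsExpOfAlgebraicIntegral y) : y ≠ 0 := by
  obtain ⟨z, f, -, hy, -⟩ := h
  exact ne_zero_of_toFun_eq_exp hy

lemma IsExpOfAlgebraicIntegral.exists_deriv_eq {y : L.top} (h : L.IsExpOfAlgebraicIntegral y) :
    ∃ f, IsAlgebraic K f ∧ y′ = f * y := by
  obtain ⟨z, f, hz, hy, hf, halg⟩ := h
  refine ⟨f, halg, L.top.toFun_injective ?_⟩
  rw [coe_derivWrt_exp hz hy, map_mul, hf]

/-- The function `z` need not belong to the field `L`, but its derivative is `y′ / y`, which does.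
-/
lemma isExpOfAlgebraicIntegral_of_toFun_eq {y : L.top} {z : L.top.surface → ℂ}
    (hz : L.top.surface.IsMeromorphic z)
    (hy : L.top.toFun y = (fun p => Complex.exp (z p) : L.top.surface → ℂ))
    (halg : IsAlgebraic K (y′ / y)) : L.IsExpOfAlgebraicIntegral y := by
  have hy0 := ne_zero_of_toFun_eq_exp hy
  refine ⟨z, y′ / y, hz, hy, ?_, halg⟩
  have h1 : L.top.toFun y * L.top.toFun y⁻¹ = 1 := by
    rw [← map_mul, mul_inv_cancel₀ hy0, map_one]
  rw [div_eq_mul_inv, map_mul, coe_derivWrt_exp hz hy, mul_assoc, h1, mul_one]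

lemma span_subset_representableField {S : Set L.top} (hS : S ⊆ L.representableField) {y : L.top}
    (hy : y ∈ Submodule.span ℂ S) : y ∈ L.representableField := by
  induction hy using Submodule.span_induction with
  | mem y hy => exact hS hy
  | zero => exact zero_mem _
  | add y z _ _ hy hz => exact add_mem hy hz
  | smul c y _ hy =>
    rw [Algebra.smul_def, IsScalarTower.algebraMap_apply ℂ K L.top]
    exact mul_mem (L.representableField.algebraMap_mem _) hy

/-- If `L = K⟨y⟩`, a homomorphism that maps `y` to a representable element maps all of `L` to
representable elements. -/
lemma isRepresentable_of_diffAdjoin_eq_top {N : Extension K} {y : L.top}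
    (htop : L.diffAdjoin {y} = ⊤) (θ : L.top →+* N.top) (hθ : ∀ z, θ z′ = (θ z)′)
    (hθK : ∀ k, θ (algebraMap K L.top k) = algebraMap K N.top k) (hy : N.IsRepresentable (θ y))
    (z : L.top) : N.IsRepresentable (θ z) := by
  let S : IntermediateField K L.top :=
    (N.representableField.toSubfield.comap θ).toIntermediateField fun k => by
      change θ _ ∈ N.representableField
      rw [hθK]
      exact N.representableField.algebraMap_mem k
  have hle : L.diffAdjoin {y} ≤ S := by
    refine L.diffAdjoin_le (fun z hz => ?_) (Set.singleton_subset_iff.2 hy)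
    change θ z′ ∈ N.representableField
    rw [hθ]
    exact deriv_mem_representableField hz
  rw [htop] at hle
  exact hle (IntermediateField.mem_top (x := z))

-- A differential subfield of `K⟨y⟩` that contains `y` is, seen in `L`, a differential subfield
-- containing `K` and `y`, so it is all of `K⟨y⟩`. Thus the adjunction can serve as an extension in
-- its own right.
variable (L) in
lemma sub_diffAdjoin_eq_top (y : L.top) :
    (L.sub (L.diffAdjoin {y}) (L.deriv_mem_diffAdjoin _)).diffAdjoin
      {(⟨y, L.subset_diffAdjoin _ rfl⟩ : L.diffAdjoin {y})} = ⊤ := by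
  set L₁ := L.sub (L.diffAdjoin {y}) (L.deriv_mem_diffAdjoin _) with hL₁
  let ι : L₁.top →+* L.top := algebraMap (L.diffAdjoin {y}) L.top
  refine eq_top_iff.2 fun z _ => L₁.mem_diffAdjoin.2 fun F hF hyF => ?_
  let G : IntermediateField K L.top := (F.toSubfield.map ι).toIntermediateField fun k =>
    ⟨algebraMap K L₁.top k, F.algebraMap_mem k, rfl⟩
  have hle : L.diffAdjoin {y} ≤ G := by
    refine L.diffAdjoin_le ?_ (Set.singleton_subset_iff.2 ⟨_, hyF rfl, rfl⟩)
    rintro _ ⟨z, hz, rfl⟩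
    exact ⟨z′, hF z hz, rfl⟩
  obtain ⟨z', hz', h⟩ := hle (SetLike.coe_mem (z : L.diffAdjoin {y}))
  rwa [← ι.injective h]

end Extension

/-- A solvable equation has a solution whose logarithmic derivative is algebraic over `K`. -/
lemma exists_isSolution_isAlgebraic_logDeriv {n : ℕ} (hn : 1 ≤ n) {a : ℕ → K} {L : Extension K}
    {v : Fin n → L.top} (hind : LinearIndependent ℂ v)
    (hv : ∀ j, IsSolution n (fun i => algebraMap K L.top (a i)) (v j))
    (hrep : ∀ j, L.IsRepresentable (v j)) :
    ∃ y : L.top, y ≠ 0 ∧ IsSolution n (fun i => algebraMap K L.top (a i)) y ∧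
      IsAlgebraic K (y′ / y) := by
  let Ω := AlgebraicClosure L.top
  let _ : Differential Ω := differentialOfIsAlgebraic L.top Ω
  have _ : DifferentialAlgebra L.top Ω := differentialAlgebra_of_isAlgebraic L.top Ω
  let φ := algebraMap L.top Ω
  have hφ : ∀ z, φ z′ = (φ z)′ := fun z => (deriv_algebraMap z).symm
  have hC : ∀ z : Ω, z′ = 0 → z ∈ Set.range (algebraMap ℂ Ω) := fun z hz =>
    mem_range_of_deriv_eq_zero_of_isAlgebraic L.top.mem_range_algebraMap_of_deriv_eq_zero hz
  have hcoef : ∀ i, φ (algebraMap K L.top (a i)) = algebraMap K Ω (a i) := fun i =>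
    (IsScalarTower.algebraMap_apply K L.top Ω (a i)).symm
  have hvΩ : ∀ j, IsSolution n (fun i => algebraMap K Ω (a i)) (φ (v j)) := fun j => by
    have := (hv j).map φ hφ
    simpa only [hcoef] using this
  have hindΩ : LinearIndependent ℂ fun j => φ (v j) :=
    hind.map' (IsScalarTower.toAlgHom ℂ L.top Ω).toLinearMap
      (LinearMap.ker_eq_bot.2 φ.injective)
  set v₀ := v ⟨0, hn⟩ with hv₀
  have hv₀0 : v₀ ≠ 0 := hind.ne_zero _
  obtain ⟨E, hE, hvE⟩ := hrep ⟨0, hn⟩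
  have huE : v₀′ / v₀ ∈ E := div_mem (hE.deriv_mem _ hvE) hvE
  have hric : IsRiccatiSolution n (fun i => algebraMap K Ω (a i)) (φ (v₀′ / v₀)) := by
    refine (isSolution_iff_isRiccatiSolution (y := φ v₀) (by simpa using hv₀0) ?_).1 (hvΩ _)
    rw [← hφ, ← map_mul, div_mul_cancel₀ _ hv₀0]
  obtain ⟨c, hcalg, hc⟩ := hE.exists_isAlgebraic_riccati
    (isAlgebraic_algebraMap (⟨_, huE⟩ : E) : IsAlgebraic E (φ (v₀′ / v₀))) hric
  -- Passing to `Ω` adds no constants, so the solution with logarithmic derivative `c` is a complex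
  -- combination of the `vⱼ` and comes from `L`.
  obtain ⟨y', hy', hy'0, hyc⟩ := hc.exists_isSolution hC hn hvΩ hindΩ
  have hspan : Submodule.span ℂ (Set.range fun j => φ (v j)) =
      (Submodule.span ℂ (Set.range v)).map (IsScalarTower.toAlgHom ℂ L.top Ω).toLinearMap := by
    rw [Submodule.map_span, ← Set.range_comp]
    rfl
  rw [hspan] at hy'
  obtain ⟨y, hy, rfl⟩ := hy'
  change φ y ≠ 0 at hy'0
  change (φ y)′ = c * φ y at hyc
  have hy0 : y ≠ 0 := by
    rintro rfl
    exact hy'0 (map_zero φ)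
  have hsol : Submodule.span ℂ (Set.range v) ≤
      solutionSpace L.top.deriv_algebraMap_complex n (fun i => algebraMap K L.top (a i)) :=
    Submodule.span_le.2 (Set.range_subset_iff.2 hv)
  refine ⟨y, hy0, hsol hy, isAlgebraic_of_map φ
    (fun r => (IsScalarTower.algebraMap_apply K L.top Ω r).symm) ?_⟩
  rw [map_div₀, hφ, hyc, mul_div_cancel_right₀ _ hy'0]
  exact hcalg

end FunctionalDiffField

/-! ### The two implications -/

namespace FunctionalDiffField

/-- If `y ≠ 0` and the derivatives of `I₁, …, Iₘ` are independent over the constants, so are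
`y, y I₁, …, y Iₘ`. -/
lemma linearIndependent_cons_mul {C F : Type*} [Field C] [Field F] [Differential F]
    [Algebra C F] (hC : ∀ c : C, (algebraMap C F c)′ = 0) {m : ℕ} {y : F} (hy : y ≠ 0)
    {I : Fin m → F} (hind : LinearIndependent C fun j => (I j)′) :
    LinearIndependent C (Fin.cons y fun j => y * I j : Fin (m + 1) → F) := by
  rw [Fintype.linearIndependent_iff] at hind ⊢
  intro g hg
  rw [Fin.sum_univ_succ] at hg
  simp only [Fin.cons_zero, Fin.cons_succ, Algebra.smul_def] at hg
  have h1 : algebraMap C F (g 0) + ∑ j : Fin m, algebraMap C F (g j.succ) * I j = 0 := by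
    refine mul_left_cancel₀ hy ?_
    rw [mul_zero, ← hg, mul_add, Finset.mul_sum, mul_comm y]
    exact congrArg _ (Finset.sum_congr rfl fun _ _ => by ring)
  have h2 : ∀ j, g (Fin.succ j) = 0 := by
    refine hind (fun j => g j.succ) ?_
    have := congrArg Differential.deriv h1
    simpa [hC, Algebra.smul_def] using this
  intro j
  refine Fin.cases ?_ h2 j
  simpa [h2] using h1

variable {K : FunctionalDiffField.{u}} {n : ℕ} {a : ℕ → K}

lemma solvableByQuadratures_of_isRepresentable (L : Extension K) {v : Fin n → L.top}
    (hind : LinearIndependent ℂ v)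
    (hv : ∀ j, IsSolution n (fun i => algebraMap K L.top (a i)) (v j))
    (hrep : ∀ j, L.IsRepresentable (v j)) : K.SolvableByQuadratures n a :=
  ⟨L, ⟨v, hind, hv⟩, fun _ hy => L.span_subset_representableField (Set.range_subset_iff.2 hrep)
    (mem_span_of_isSolution L.top.mem_range_algebraMap_of_deriv_eq_zero hv hind hy)⟩

/-- The chosen solution is pulled back to a subsurface on which it has a logarithm. There the
ambient field plays two roles: it contains `K⟨y₁⟩`, and it is an extension of `K⟨y₁⟩` containing the
solutions of the reduced equation. -/
lemma SolvableByQuadratures.exists_reduction (hn : 1 ≤ n) (h : K.SolvableByQuadratures n a) :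
    ∃ (L : Extension K) (y₁ : L.top), L.diffAdjoin {y₁} = ⊤ ∧
      IsSolution n (fun i => algebraMap K L.top (a i)) y₁ ∧ L.IsExpOfAlgebraicIntegral y₁ ∧
      L.top.SolvableByQuadratures (n - 1)
        (reducedCoeff n (fun i => algebraMap K L.top (a i)) y₁) := by
  obtain ⟨L, ⟨v, hind, hv⟩, hrep⟩ := h
  obtain ⟨y, hy0, hy, hyalg⟩ :=
    exists_isSolution_isAlgebraic_logDeriv hn hind hv fun j => hrep _ (hv j)
  obtain ⟨R, z, hz, hyz⟩ := Extension.exists_log hy0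
  let φ := algebraMap L.top R.top
  have hφ : ∀ z, φ z′ = (φ z)′ := fun z => (deriv_algebraMap z).symm
  let N := L.trans R
  let y' : N.top := φ y
  have hy'0 : y' ≠ 0 := (map_ne_zero φ).2 hy0
  let E := N.diffAdjoin {y'}
  let L₁ := N.sub E (N.deriv_mem_diffAdjoin _)
  let M := N.overSub E (N.deriv_mem_diffAdjoin _)
  let y₁ : L₁.top := (⟨y', N.subset_diffAdjoin _ rfl⟩ : E)
  let ι := algebraMap L₁.top M.top
  have hι : ∀ z, ι z′ = (ι z)′ := fun z => (deriv_algebraMap z).symm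
  have hyM : IsSolution n (fun i => ι (algebraMap K L₁.top (a i))) (ι y₁) := hy.map φ hφ
  have hvM : ∀ j, IsSolution n (fun i => ι (algebraMap K L₁.top (a i))) (φ (v j)) :=
    fun j => (hv j).map φ hφ
  refine ⟨L₁, y₁, N.sub_diffAdjoin_eq_top y', hyM.of_map ι hι,
    Extension.isExpOfAlgebraicIntegral_of_toFun_eq (L := L₁) (y := y₁) hz hyz ?_, ?_⟩
  · let ι' : L₁.top →+* N.top := ι
    refine isAlgebraic_of_map (R := K) ι' (fun _ => rfl) ?_
    let φ' : L.top →+* N.top := φ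
    have h1 : φ (y′ / y) = (φ y)′ / φ y := by rw [map_div₀, hφ]
    have h2 : ι' (y₁′ / y₁) = φ' (y′ / y) :=
      ((map_div₀ ι _ _).trans (congrArg (· / ι y₁) (hι y₁))).trans h1.symm
    rw [h2]
    exact isAlgebraic_map (RingHom.id K) φ' (fun _ => rfl) hyalg
  · have hindM : LinearIndependent ℂ fun j => (φ (v j) : M.top) :=
      hind.map' (IsScalarTower.toAlgHom ℂ L.top R.top).toLinearMap
        (LinearMap.ker_eq_bot.2 φ.injective)
    -- Representability over `K` passes to the larger base field `K⟨y₁⟩`.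
    have hrepM : ∀ j, M.IsRepresentable (φ (v j)) := fun j =>
      Extension.IsRepresentable.map (L' := M) φ hφ
        (fun k => M.representableField.algebraMap_mem (algebraMap K L₁.top k)) (hrep _ (hv j))
    obtain ⟨w, hw, hwv⟩ := exists_linearIndependent_reduced M.top.deriv_algebraMap_complex
      M.top.mem_range_algebraMap_of_deriv_eq_zero hindM (y₁ := ι y₁) hy'0
    refine solvableByQuadratures_of_isRepresentable M hw (fun j => ?_) fun j => ?_
    · obtain ⟨s, hs, hws⟩ := hwv j
      have hsol : Submodule.span ℂ (Set.range fun j => (φ (v j) : M.top)) ≤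
          solutionSpace M.top.deriv_algebraMap_complex n
            (fun i => ι (algebraMap K L₁.top (a i))) :=
        Submodule.span_le.2 (Set.range_subset_iff.2 hvM)
      have := IsSolution.reduced (y₁ := ι y₁) hn hy'0 hyM (hsol hs)
      rw [← funext (map_reducedCoeff ι hι n _ y₁), ← hws] at this
      exact this
    · obtain ⟨s, hs, hws⟩ := hwv j
      rw [hws]
      exact Extension.deriv_mem_representableField (div_mem
        (Extension.span_subset_representableField (Set.range_subset_iff.2 hrepM) hs)
        (M.representableField.algebraMap_mem y₁))

/-- The basis is `y₁` followed by the products of `y₁` with the integrals of a basis of the reduced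
equation. Quadratures over `K⟨y₁⟩` become quadratures over `K`, since `y₁` and hence all of `K⟨y₁⟩`
is representable over `K`. -/
lemma solvableByQuadratures_of_reduction (hn : 1 ≤ n) {L : Extension K} {y₁ : L.top}
    (htop : L.diffAdjoin {y₁} = ⊤) (hy : IsSolution n (fun i => algebraMap K L.top (a i)) y₁)
    (hexp : L.IsExpOfAlgebraicIntegral y₁)
    (h : L.top.SolvableByQuadratures (n - 1)
      (reducedCoeff n (fun i => algebraMap K L.top (a i)) y₁)) :
    K.SolvableByQuadratures n a := by
  obtain ⟨m, rfl⟩ : ∃ m, n = m + 1 := ⟨n - 1, by omega⟩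
  obtain ⟨M, ⟨w, hind, hw⟩, hrep⟩ := h
  -- The integrals need not exist in `M`, so the surface is restricted once more.
  obtain ⟨R, I, hI⟩ := Extension.exists_integral w
  obtain ⟨f, hf, hyf⟩ := hexp.exists_deriv_eq
  let N := (L.trans M).trans R
  let φ : M.top →+* N.top := algebraMap M.top R.top
  have hφ : ∀ z, φ z′ = (φ z)′ := fun z => (deriv_algebraMap (B := R.top) z).symm
  let θ : L.top →+* N.top := φ.comp (algebraMap L.top M.top)
  have hθ : ∀ z, θ z′ = (θ z)′ := fun z => by
    simp only [θ, RingHom.comp_apply, ← hφ, deriv_algebraMap]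
  have hy0 : θ y₁ ≠ 0 := (map_ne_zero θ).2 hexp.ne_zero
  have hyN : IsSolution (m + 1) (fun i => algebraMap K N.top (a i)) (θ y₁) := hy.map θ hθ
  have hyrep : θ y₁ ∈ N.representableField := by
    refine Extension.mem_representableField_of_deriv_eq (a := θ f) ?_
      (by rw [← hθ, hyf, map_mul])
    exact Extension.mem_representableField_of_isAlgebraic
      (isAlgebraic_map (algebraMap K N.representableField) θ (fun _ => rfl) hf)
  have hLrep : ∀ z, N.IsRepresentable (θ z) :=
    Extension.isRepresentable_of_diffAdjoin_eq_top htop θ hθ (fun _ => rfl) hyrep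
  have hIrep : ∀ j, I j ∈ N.representableField := fun j => by
    refine Extension.mem_representableField_of_deriv_mem (L := N) ?_
    have : N.IsRepresentable (φ (w j)) :=
      Extension.IsRepresentable.map (L' := N) φ hφ hLrep (hrep _ (hw j))
    exact (hI j).symm ▸ this
  have hindN : LinearIndependent ℂ fun j => (I j)′ := by
    simp only [hI]
    exact hind.map' (IsScalarTower.toAlgHom ℂ M.top R.top).toLinearMap
      (LinearMap.ker_eq_bot.2 (algebraMap M.top R.top).injective)
  refine solvableByQuadratures_of_isRepresentable N
    (linearIndependent_cons_mul N.top.deriv_algebraMap_complex hy0 hindN) (fun j => ?_) fun j => ?_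
  · refine Fin.cases hyN (fun j => ?_) j
    refine IsSolution.of_reduced hn hy0 hyN ?_
    have h1 : IsSolution m (fun i => θ (reducedCoeff (m + 1) _ y₁ i)) (φ (w j)) :=
      (hw j).map φ hφ
    rw [funext (map_reducedCoeff θ hθ (m + 1) _ y₁), show φ (w j) = _ from (hI j).symm] at h1
    exact h1
  · refine Fin.cases hyrep (fun j => ?_) j
    exact mul_mem hyrep (hIrep j)

end FunctionalDiffField

theorem theorem35 (K : FunctionalDiffField.{u}) (n : ℕ) (hn : 1 ≤ n) (a : ℕ → K) :
    K.SolvableByQuadratures n a ↔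
      ∃ (L : K.Extension) (y₁ : L.top),
        L.diffAdjoin {y₁} = ⊤ ∧
        FunctionalDiffField.IsSolution n (fun i => algebraMap K L.top (a i)) y₁ ∧
        L.IsExpOfAlgebraicIntegral y₁ ∧
        L.top.SolvableByQuadratures (n - 1)
          (FunctionalDiffField.reducedCoeff n (fun i => algebraMap K L.top (a i)) y₁) :=
  ⟨fun h => h.exists_reduction hn, fun ⟨_, _, htop, hy, hexp, h⟩ =>
    FunctionalDiffField.solvableByQuadratures_of_reduction hn htop hy hexp h⟩
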